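/- Let $G=(V,E)$ be a finite simple graph with edge weights $w:E\to\mathbb R$. A \emph{dual solution} $y$ gives a number $y_v$ to every vertex and $y_S$ to every odd set $S\subseteq V$ with $|S|>1$; $\mathrm{slack}(uv)=w_{uv}-y_u-y_v-\sum_{S:\,uv\in\delta(S)}y_S$, and $y$ is \emph{feasible} if all slacks are $\ge 0$ and all $y_S\ge 0$ $(|S|>1)$. An edge is \emph{tight} if its slack is $0$. \emph{Cherry forests.} Let $H$ be a graph, possibly obtained by contracting disjoint vertex sets (its nodes are then the contracted sets, its edges are original edges), with a matching $M$ and sets of plus-nodes and minus-nodes (nodes in both are $\pm$-nodes, nodes in neither are free, plus-nodes that are not minus-nodes are purely plus-nodes, and similarly for purely minus-nodes). Unmatched nodes are called roots and are purely plus-nodes; every other plus-node has a matched incident edge as plus-parent, and every minus-node an unmatched incident edge as minus-parent. For a plus-node (minus-node) $v$ let $\mathcal P^+_v$ ($\mathcal P^-_v$) be the path from $v$ that follows plus- and minus-parents in alternation, starting with the plus-parent (minus-parent) of $v$. This is a \emph{cherry forest} if all these paths are simple and end at a root, and every $\pm$-node $v$ has a purely plus-node $\mathfrak r_v$, its receptacle,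 which lies on $\mathcal P^+_v$ and $\mathcal P^-_v$ and before which all nodes of these paths are $\pm$-nodes. The \emph{tree} of a root $r$ consists of the nodes whose paths end at $r$. The \emph{cherry blossom} of a purely plus-node $x$ consists of $x$ and all $\pm$-nodes $v$ with $\mathfrak r_v=x$. \emph{States.} A state of Blossom VI consists of a laminar family of supernodes (vertex sets with more than one vertex), a feasible $y$ with $y_S=0$ for all $S$ with $|S|>1$ that are not supernodes, and matchings and cherry forests, with all matched edges and all parents tight, on the current graph (in which the maximal supernodes are contracted) and inside each supernode (with its maximal sub-supernodes contracted). Here every supernode has an odd number of elements, exactly one of them unmatched inside it, and all others $\pm$-nodes of its cherry forest; and in the current graph the mate of every minus-node is a plus-node. A state of a traditional multi-tree blossom algorithm is the same, except that the current graph carries an ordinary alternating forest (no $\pm$-nodes) and each contracted set is a traditional blossom: its $2k+1\ge 3$ elements form an odd cycle of tight edges, $k$ of which are matched, and the matched edges between its elements form a matching. \emph{Updates.} Primal updates of Blossom VI are possible in these cases, all in the current graph: (grow-out) a tight edge joins a plus-node to a free node whose mate is free; (grow-in) a tight edge joins two plus-nodes of the same tree in different cherry blossoms; (augment) a tight edge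 joins plus-nodes of different trees; (shrink) some cherry blossom has more than one node; (expand) some purely minus-node is a supernode with zero dual variable. For the traditional algorithm they are grow, augment and expand as above, and shrink when a tight edge joins two different plus-nodes of one tree. If the current graph has no $\pm$-nodes, a dual update chooses $\delta_T\ge 0$ for each tree $T$, adds $\delta_T$ to $y$ on plus-nodes of $T$ and subtracts it on minus-nodes of $T$, so that $y$ remains feasible; it makes progress if $\delta\ne 0$ and no other feasible choice $\delta'$ satisfies $\delta'\ge\delta$ (so there is no progress if only $\delta=0$ is feasible, or if feasible $\delta$ can be increased forever). A state is \emph{stuck} if there is at least one tree, no primal update is possible, and no dual update makes progress. Then: (1) For every cherry forest and every purely plus-node $x$ of it, the contraction of the cherry blossom of $x$ to a single node is the result of a (possibly empty) sequence of traditional blossom shrinks, each contracting an odd alternating cycle ($2k+1\ge3$ nodes, $k$ matched edges) whose unmatched-in-the-cycle node is $x$ or the node into which $x$ has been contracted. (2) Every state of Blossom VI is realized by a state of a traditional multi-tree blossom algorithm with the same matched edges and the same dual solution, whose blossoms include all supernodes, and whose current nodes, with their labels and parents, are those obtained by shrinking all cherry blossoms of the current graph (a shrunk cherry blossom takes over the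 labels and the parent of its receptacle). If the state of Blossom VI is stuck, so is this state of the traditional algorithm. (3) If a state of Blossom VI is stuck, then $G$ has no perfect matching. -/

import Mathlib

namespace Blossom

/-! The input is a finite simple graph `G` on `V` with edge weights `w : Sym2 V → ℝ`.
A *node* of a contracted graph is identified with the set of input vertices it stands for;
an edge of a contracted graph is an edge of the input graph joining two different nodes. -/

/-! ### Dual variables and slacks -/

/-- The slack `w_e - y_u - y_v - ∑ y_S` of `e = ab`, the sum being over the odd sets `S` with more
than one vertex and `e ∈ δ(S)`. The variable of a vertex `v` is `y {v}`. -/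
def slack {V : Type*} [Fintype V] [DecidableEq V] (w : Sym2 V → ℝ) (y : Finset V → ℝ)
    (a b : V) : ℝ :=
  w s(a, b) - y {a} - y {b}
    - ∑ S : Finset V with Odd S.card ∧ 1 < S.card ∧ (a ∈ S ∧ b ∉ S ∨ b ∈ S ∧ a ∉ S), y S

theorem slack_comm {V : Type*} [Fintype V] [DecidableEq V] (w : Sym2 V → ℝ) (y : Finset V → ℝ)
    (a b : V) : slack w y a b = slack w y b a := by
  unfold slack
  rw [Sym2.eq_swap, sub_right_comm (w s(b, a))]
  simp only [or_comm]

/-- The graph `(V, E₀)` of the edges of zero slack. -/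
def tightGraph {V : Type*} [Fintype V] [DecidableEq V] (G : SimpleGraph V) (w : Sym2 V → ℝ)
    (y : Finset V → ℝ) : SimpleGraph V where
  Adj a b := G.Adj a b ∧ slack w y a b = 0
  symm := ⟨fun a b h => ⟨h.1.symm, by rw [slack_comm]; exact h.2⟩⟩
  loopless := ⟨fun a h => G.loopless.irrefl a h.1⟩

/-- Feasibility for the dual linear program. -/
def DualFeasible {V : Type*} [Fintype V] [DecidableEq V] (G : SimpleGraph V) (w : Sym2 V → ℝ)
    (y : Finset V → ℝ) : Prop :=
  (∀ a b, G.Adj a b → 0 ≤ slack w y a b) ∧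
    ∀ S : Finset V, Odd S.card → 1 < S.card → 0 ≤ y S

/-! ### Nodes -/

/-- All nodes: the vertices of the input graph and the supernodes in `𝓑`. -/
def nodes {V : Type*} [Fintype V] [DecidableEq V] (𝓑 : Finset (Finset V)) :
    Finset (Finset V) :=
  Finset.univ.image (fun v : V => {v}) ∪ 𝓑

/-- The nodes of the current graph: those not contained in a larger node. -/
def topNodes {V : Type*} [Fintype V] [DecidableEq V] (𝓑 : Finset (Finset V)) :
    Finset (Finset V) :=
  (nodes 𝓑).filter fun S => ∀ T ∈ nodes 𝓑, ¬ S ⊂ T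

/-- The elements of the supernode `B`, i.e. the largest nodes properly contained in it. -/
def children {V : Type*} [Fintype V] [DecidableEq V] (𝓑 : Finset (Finset V)) (B : Finset V) :
    Finset (Finset V) :=
  (nodes 𝓑).filter fun S => S ⊂ B ∧ ∀ T ∈ nodes 𝓑, S ⊂ T → ¬ T ⊂ B

/-- Contracted sets are non-trivial and nested or disjoint. -/
def IsLaminar {V : Type*} (𝓑 : Finset (Finset V)) : Prop :=
  (∀ B ∈ 𝓑, 1 < B.card) ∧ ∀ A ∈ 𝓑, ∀ B ∈ 𝓑, A ⊆ B ∨ B ⊆ A ∨ Disjoint A B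

/-- The node set of a contracted graph: non-empty, pairwise disjoint sets of vertices. -/
def IsNodeSet {V : Type*} (𝒩 : Finset (Finset V)) : Prop :=
  (∀ u ∈ 𝒩, u.Nonempty) ∧ ∀ u ∈ 𝒩, ∀ v ∈ 𝒩, u ≠ v → Disjoint u v

/-! ### Matchings, labels and parents -/

/-- Matched edges, plus- and minus-nodes, plus- and minus-parents. A parent `(a, b)` of a node
`u` is an arc with `a ∈ u` that leads to the node containing `b`.
The data of all contracted graphs (the current one and those inside the supernodes) are kept
together: each edge joins different nodes in exactly one of them. -/
structure AltData (V : Type*) where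
  M : Finset (Sym2 V)
  plus : Finset (Finset V)
  minus : Finset (Finset V)
  plusParent : Finset V → V × V
  minusParent : Finset V → V × V

namespace AltData

variable {V : Type*}

/-- In the graph obtained from `H` with node set `𝒩`, the edges of `M` form a matching. -/
def IsMatching (D : AltData V) (H : SimpleGraph V) (𝒩 : Finset (Finset V)) : Prop :=
  (∀ u ∈ 𝒩, ∀ v ∈ 𝒩, u ≠ v → ∀ a ∈ u, ∀ b ∈ v, s(a, b) ∈ D.M → H.Adj a b) ∧
    ∀ u ∈ 𝒩, ∀ v ∈ 𝒩, ∀ v' ∈ 𝒩, u ≠ v → u ≠ v' →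
      ∀ a ∈ u, ∀ b ∈ v, ∀ a' ∈ u, ∀ b' ∈ v',
        s(a, b) ∈ D.M → s(a', b') ∈ D.M → a = a' ∧ b = b'

/-- `x` and `y` are the end nodes of a matched edge. -/
def Mates (D : AltData V) (x y : Finset V) : Prop :=
  x ≠ y ∧ ∃ a ∈ x, ∃ b ∈ y, s(a, b) ∈ D.M

/-- A root is an unmatched node. -/
def IsRoot (D : AltData V) (𝒩 : Finset (Finset V)) (r : Finset V) : Prop :=
  r ∈ 𝒩 ∧ ∀ v ∈ 𝒩, ¬ D.Mates r v

/-- A free node has no label. -/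
def IsFree (D : AltData V) (u : Finset V) : Prop := u ∉ D.plus ∧ u ∉ D.minus

/-- `D.AltPath 𝒩 v true l`: following from `v` parents of alternating type, first the plus-parent
of `v`, one arrives at a root, and `l` lists the nodes visited, including `v` and the root.
With `false` the first arc is the minus-parent of `v`. -/
inductive AltPath (D : AltData V) (𝒩 : Finset (Finset V)) :
    Finset V → Bool → List (Finset V) → Prop
  | root (r : Finset V) (hr : D.IsRoot 𝒩 r) : AltPath D 𝒩 r true [r]
  | plus (v v' : Finset V) (l : List (Finset V)) (hv : v ∈ 𝒩) (hp : v ∈ D.plus)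
      (hr : ¬ D.IsRoot 𝒩 v) (hv' : v' ∈ 𝒩) (h : (D.plusParent v).2 ∈ v')
      (hl : AltPath D 𝒩 v' false l) : AltPath D 𝒩 v true (v :: l)
  | minus (v v' : Finset V) (l : List (Finset V)) (hv : v ∈ 𝒩) (hm : v ∈ D.minus)
      (hv' : v' ∈ 𝒩) (h : (D.minusParent v).2 ∈ v')
      (hl : AltPath D 𝒩 v' true l) : AltPath D 𝒩 v false (v :: l)

/-- `v` belongs to the tree with root `r`. -/
def InTree (D : AltData V) (𝒩 : Finset (Finset V)) (r v : Finset V) : Prop :=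
  ∃ (b : Bool) (l : List (Finset V)), D.AltPath 𝒩 v b l ∧ l.getLast? = some r

/-- Forest of alternating paths in the graph obtained from `H` with node set `𝒩`: `M` is a
matching, roots are purely plus-nodes, every other plus-node has a matched incident edge as its
plus-parent, every minus-node has an unmatched incident edge as its minus-parent, and following
parents in alternating order gives simple paths that end at a root. -/
structure IsForest (D : AltData V) (H : SimpleGraph V) (𝒩 : Finset (Finset V)) : Prop where
  matching : D.IsMatching H 𝒩
  root : ∀ r, D.IsRoot 𝒩 r → r ∈ D.plus ∧ r ∉ D.minus
  plusParent : ∀ u ∈ 𝒩, u ∈ D.plus → ¬ D.IsRoot 𝒩 u →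
    (D.plusParent u).1 ∈ u ∧ (∃ v ∈ 𝒩, v ≠ u ∧ (D.plusParent u).2 ∈ v) ∧
      H.Adj (D.plusParent u).1 (D.plusParent u).2 ∧
      s((D.plusParent u).1, (D.plusParent u).2) ∈ D.M
  minusParent : ∀ u ∈ 𝒩, u ∈ D.minus →
    (D.minusParent u).1 ∈ u ∧ (∃ v ∈ 𝒩, v ≠ u ∧ (D.minusParent u).2 ∈ v) ∧
      H.Adj (D.minusParent u).1 (D.minusParent u).2 ∧
      s((D.minusParent u).1, (D.minusParent u).2) ∉ D.M
  plusPath : ∀ u ∈ 𝒩, u ∈ D.plus → ∃ l, D.AltPath 𝒩 u true l ∧ l.Nodup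
  minusPath : ∀ u ∈ 𝒩, u ∈ D.minus → ∃ l, D.AltPath 𝒩 u false l ∧ l.Nodup

/-- Labels are given to both ends of a matched edge: the mate of a minus-node is a plus-node. -/
def MinusMatched (D : AltData V) (𝒩 : Finset (Finset V)) : Prop :=
  ∀ u ∈ 𝒩, u ∈ D.minus → ∃ v ∈ 𝒩, v ∈ D.plus ∧ D.Mates u v

/-- No node is both a plus- and a minus-node. -/
def NoPlusMinus (D : AltData V) (𝒩 : Finset (Finset V)) : Prop :=
  ∀ u ∈ 𝒩, ¬ (u ∈ D.plus ∧ u ∈ D.minus)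

/-- Some edge of `H` joins `u` and `v`. -/
def Joined (H : SimpleGraph V) (u v : Finset V) : Prop := ∃ a ∈ u, ∃ b ∈ v, H.Adj a b

/-- A plus-node `v` is joined to a free node `x` that is matched to a free node `z`. -/
def CanGrow (D : AltData V) (H : SimpleGraph V) (𝒩 : Finset (Finset V)) : Prop :=
  ∃ v ∈ 𝒩, ∃ x ∈ 𝒩, ∃ z ∈ 𝒩, v ∈ D.plus ∧ Joined H v x ∧ D.Mates x z ∧
    D.IsFree x ∧ D.IsFree z

/-- Plus-nodes of different trees are joined. -/
def CanAugment (D : AltData V) (H : SimpleGraph V) (𝒩 : Finset (Finset V)) : Prop :=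
  ∃ u ∈ 𝒩, ∃ v ∈ 𝒩, u ∈ D.plus ∧ v ∈ D.plus ∧ Joined H u v ∧
    ∃ r r', D.InTree 𝒩 r u ∧ D.InTree 𝒩 r' v ∧ r ≠ r'

/-- Some purely minus-node is a supernode with zero dual variable. -/
def CanExpand (D : AltData V) (𝓑 : Finset (Finset V)) (y : Finset V → ℝ)
    (𝒩 : Finset (Finset V)) : Prop :=
  ∃ v ∈ 𝒩, v ∈ D.minus ∧ v ∉ D.plus ∧ v ∈ 𝓑 ∧ y v = 0

/-- `y'` arises from `y` by the dual update with step `δ r ≥ 0` for the tree with root `r`: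
plus-nodes of that tree go up by `δ r`, minus-nodes go down by `δ r`, all else is kept. -/
def IsDualUpdate (D : AltData V) (𝒩 : Finset (Finset V)) (δ y y' : Finset V → ℝ) : Prop :=
  (∀ r, D.IsRoot 𝒩 r → 0 ≤ δ r) ∧ (∀ r, ¬ D.IsRoot 𝒩 r → δ r = 0) ∧
    (∀ r u, D.InTree 𝒩 r u →
      (u ∈ D.plus → y' u = y u + δ r) ∧ (u ∈ D.minus → y' u = y u - δ r)) ∧
    ∀ S, (∀ r, ¬ D.InTree 𝒩 r S) → y' S = y S

/-- The steps `δ` give a dual update that keeps the dual solution feasible. -/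
def IsFeasibleStep [Fintype V] [DecidableEq V] (D : AltData V) (G : SimpleGraph V)
    (w : Sym2 V → ℝ) (𝒩 : Finset (Finset V)) (y δ : Finset V → ℝ) : Prop :=
  ∃ y', D.IsDualUpdate 𝒩 δ y y' ∧ DualFeasible G w y'

/-- A dual update makes progress: no node is a `±`-node, and there are feasible steps, not all
zero, that have been increased as far as possible. (If there are no feasible steps but zero, or
if feasible steps can be increased forever, there is no such update.) -/
def DualProgress [Fintype V] [DecidableEq V] (D : AltData V) (G : SimpleGraph V)
    (w : Sym2 V → ℝ) (𝒩 : Finset (Finset V)) (y : Finset V → ℝ) : Prop :=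
  D.NoPlusMinus 𝒩 ∧ ∃ δ, D.IsFeasibleStep G w 𝒩 y δ ∧ (∃ r, 0 < δ r) ∧
    ∀ δ', D.IsFeasibleStep G w 𝒩 y δ' → (∀ r, δ r ≤ δ' r) → δ' = δ

end AltData

/-! ### Cherry forests and cherry blossoms -/

/-- The data of a cherry forest: also every `±`-node has a receptacle. -/
structure CherryData (V : Type*) extends AltData V where
  receptacle : Finset V → Finset V

namespace CherryData

variable {V : Type*} [DecidableEq V]

/-- Cherry forest in the graph obtained from `H` with node set `𝒩`: the receptacle of a `±`-node
`u` is a purely plus-node which lies on both alternating paths from `u` to the root, and all nodes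
before it on these paths are `±`-nodes. -/
structure IsCherryForest (D : CherryData V) (H : SimpleGraph V) (𝒩 : Finset (Finset V)) :
    Prop extends D.toAltData.IsForest H 𝒩 where
  receptacle_plus : ∀ u ∈ 𝒩, u ∈ D.plus → u ∈ D.minus →
    D.receptacle u ∈ 𝒩 ∧ D.receptacle u ∈ D.plus ∧ D.receptacle u ∉ D.minus
  receptacle_path : ∀ u ∈ 𝒩, u ∈ D.plus → u ∈ D.minus → ∀ b l, D.AltPath 𝒩 u b l →
    D.receptacle u ∈ l ∧
      ∀ v ∈ l.takeWhile (fun v => v ≠ D.receptacle u), v ∈ D.plus ∧ v ∈ D.minus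

/-- The cherry blossom with receptacle `x`, including `x`. -/
def cherryBlossom (D : CherryData V) (𝒩 : Finset (Finset V)) (x : Finset V) :
    Finset (Finset V) :=
  insert x (𝒩.filter fun v => v ∈ D.plus ∧ v ∈ D.minus ∧ D.receptacle v = x)

/-- The receptacle of the cherry blossom of the plus-node `u`, which may be `u` alone. -/
def base (D : CherryData V) (u : Finset V) : Finset V :=
  if u ∈ D.plus ∧ u ∈ D.minus then D.receptacle u else u

end CherryData

/-- The node obtained by contracting the nodes in `C`. -/
def merge {V : Type*} [DecidableEq V] (C : Finset (Finset V)) : Finset V := C.biUnion id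

/-- The node set after contracting the nodes in `C`. -/
def contract {V : Type*} [DecidableEq V] (𝒩 C : Finset (Finset V)) : Finset (Finset V) :=
  insert (merge C) (𝒩 \ C)

/-! ### Traditional blossoms -/

/-- `c 0, …, c (2k)` with `k ≥ 1` is an odd cycle of distinct nodes of `𝒩`, with edges `e i` of `H`
from `c i` to `c (i + 1)` (cyclically), of which `e 1, e 3, …, e (2k - 1)` are matched and the others
are not: an odd alternating cycle with base `c 0`. -/
structure IsOddCycle {V : Type*} (H : SimpleGraph V) (M : Finset (Sym2 V))
    (𝒩 : Finset (Finset V)) (k : ℕ) (c : Fin (2 * k + 1) → Finset V)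
    (e : Fin (2 * k + 1) → V × V) : Prop where
  pos : 1 ≤ k
  mem : ∀ i, c i ∈ 𝒩
  inj : Function.Injective c
  edge : ∀ i, (e i).1 ∈ c i ∧ (e i).2 ∈ c (i + 1) ∧ H.Adj (e i).1 (e i).2
  alternating : ∀ i, s((e i).1, (e i).2) ∈ M ↔ Odd (i : ℕ)

/-- `𝒩'` arises from `𝒩` by shrinking an odd alternating cycle whose base is the node `x` or
a node into which `x` has been contracted. -/
def OddCycleShrink {V : Type*} [DecidableEq V] (H : SimpleGraph V) (M : Finset (Sym2 V))
    (x : Finset V) (𝒩 𝒩' : Finset (Finset V)) : Prop :=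
  ∃ (k : ℕ) (c : Fin (2 * k + 1) → Finset V) (e : Fin (2 * k + 1) → V × V),
    IsOddCycle H M 𝒩 k c e ∧ x ⊆ c 0 ∧ 𝒩' = contract 𝒩 (Finset.univ.image c)

/-! ### States of the traditional multi-tree algorithm -/

/-- Blossoms, dual variables, matching and alternating forest. -/
structure TradState (V : Type*) extends AltData V where
  blossoms : Finset (Finset V)
  y : Finset V → ℝ

namespace TradState

variable {V : Type*} [Fintype V] [DecidableEq V]

/-- The current nodes. -/
def top (t : TradState V) : Finset (Finset V) := topNodes t.blossoms

/-- The invariants of a traditional multi-tree blossom algorithm: blossoms are nested odd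
alternating cycles of tight edges, the current graph carries a matching and an alternating forest
of tight edges, the dual solution is feasible and supported on nodes. -/
structure IsValid (t : TradState V) (G : SimpleGraph V) (w : Sym2 V → ℝ) : Prop where
  laminar : IsLaminar t.blossoms
  feasible : DualFeasible G w t.y
  support : ∀ S : Finset V, 1 < S.card → S ∉ t.blossoms → t.y S = 0
  cycle : ∀ B ∈ t.blossoms,
    t.IsMatching (tightGraph G w t.y) (children t.blossoms B) ∧
      ∃ (k : ℕ) (c : Fin (2 * k + 1) → Finset V) (e : Fin (2 * k + 1) → V × V),
        IsOddCycle (tightGraph G w t.y) t.M (children t.blossoms B) k c e ∧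
          Finset.univ.image c = children t.blossoms B
  forest : t.IsForest (tightGraph G w t.y) t.top
  alternating : t.NoPlusMinus t.top
  minusMatched : t.MinusMatched t.top

/-- Two plus-nodes of the same tree are joined by a tight edge. -/
def CanShrink (t : TradState V) (H : SimpleGraph V) : Prop :=
  ∃ u ∈ t.top, ∃ v ∈ t.top, u ≠ v ∧ u ∈ t.plus ∧ v ∈ t.plus ∧ AltData.Joined H u v ∧
    ∃ r, t.InTree t.top r u ∧ t.InTree t.top r v

/-- A grow, augment, shrink or expand operation is possible. -/
def PrimalProgress (t : TradState V) (G : SimpleGraph V) (w : Sym2 V → ℝ) : Prop :=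
  t.CanGrow (tightGraph G w t.y) t.top ∨ t.CanAugment (tightGraph G w t.y) t.top ∨
    t.CanShrink (tightGraph G w t.y) ∨ t.CanExpand t.blossoms t.y t.top

/-- Trees exist, and neither a primal nor a dual update makes progress. -/
def IsStuck (t : TradState V) (G : SimpleGraph V) (w : Sym2 V → ℝ) : Prop :=
  (∃ r, t.IsRoot t.top r) ∧ ¬ t.PrimalProgress G w ∧ ¬ t.DualProgress G w t.top t.y

end TradState

/-! ### States of Blossom VI -/

/-- Supernodes, dual variables, matchings and cherry forests (of the current graph and inside
the supernodes). -/
structure CherryState (V : Type*) extends CherryData V where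
  blossoms : Finset (Finset V)
  y : Finset V → ℝ

namespace CherryState

variable {V : Type*} [Fintype V] [DecidableEq V]

/-- The current nodes. -/
def top (s : CherryState V) : Finset (Finset V) := topNodes s.blossoms

/-- The invariants of Blossom VI: a supernode has an odd number of elements, which form a cherry
forest of tight edges with one unmatched node, all other nodes being `±`-nodes; the current graph
carries a cherry forest of tight edges; the dual solution is feasible and supported on nodes. -/
structure IsValid (s : CherryState V) (G : SimpleGraph V) (w : Sym2 V → ℝ) : Prop where
  laminar : IsLaminar s.blossoms
  feasible : DualFeasible G w s.y
  support : ∀ S : Finset V, 1 < S.card → S ∉ s.blossoms → s.y S = 0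
  supernode : ∀ B ∈ s.blossoms,
    Odd (children s.blossoms B).card ∧
      s.IsCherryForest (tightGraph G w s.y) (children s.blossoms B) ∧
      ∃ r, s.IsRoot (children s.blossoms B) r ∧
        ∀ u ∈ children s.blossoms B, u ≠ r → u ∈ s.plus ∧ u ∈ s.minus
  forest : s.IsCherryForest (tightGraph G w s.y) s.top
  minusMatched : s.MinusMatched s.top

/-- Plus-nodes of the same tree but of different cherry blossoms are joined by a tight edge. -/
def CanGrowIn (s : CherryState V) (H : SimpleGraph V) : Prop :=
  ∃ u ∈ s.top, ∃ v ∈ s.top, u ∈ s.plus ∧ v ∈ s.plus ∧ s.base u ≠ s.base v ∧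
    AltData.Joined H u v ∧ ∃ r, s.InTree s.top r u ∧ s.InTree s.top r v

/-- There is a cherry blossom that consists of more than its receptacle. -/
def CanShrink (s : CherryState V) : Prop :=
  ∃ x ∈ s.top, x ∈ s.plus ∧ x ∉ s.minus ∧ s.cherryBlossom s.top x ≠ {x}

/-- A grow-out, grow-in, augment, shrink or expand operation is possible. -/
def PrimalProgress (s : CherryState V) (G : SimpleGraph V) (w : Sym2 V → ℝ) : Prop :=
  s.CanGrow (tightGraph G w s.y) s.top ∨ s.CanGrowIn (tightGraph G w s.y) ∨
    s.CanAugment (tightGraph G w s.y) s.top ∨ s.CanShrink ∨ s.CanExpand s.blossoms s.y s.top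

/-- Trees exist, and neither a primal nor a dual update makes progress. -/
def IsStuck (s : CherryState V) (G : SimpleGraph V) (w : Sym2 V → ℝ) : Prop :=
  (∃ r, s.IsRoot s.top r) ∧ ¬ s.PrimalProgress G w ∧ ¬ s.DualProgress G w s.top s.y

/-- The nodes of the current graph that are not `±`-nodes. Each `±`-node lies in the cherry blossom
of exactly one of them. -/
def pureTop (s : CherryState V) : Finset (Finset V) :=
  s.top.filter fun x => ¬ (x ∈ s.plus ∧ x ∈ s.minus)

/-- The node that `x` becomes when all cherry blossoms are shrunk. -/
def shrunk (s : CherryState V) (x : Finset V) : Finset V := merge (s.cherryBlossom s.top x)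

/-- The traditional state `t` realizes the state that `s` reaches when all its cherry blossoms are
shrunk: same matching, same dual variables, same current nodes with the same labels and parents,
and every supernode of `s` is a blossom of `t`. -/
structure RealizedBy (s : CherryState V) (t : TradState V) : Prop where
  M : t.M = s.M
  y : t.y = s.y
  blossoms : s.blossoms ⊆ t.blossoms
  top : t.top = s.pureTop.image s.shrunk
  plus : ∀ x ∈ s.pureTop, s.shrunk x ∈ t.plus ↔ x ∈ s.plus
  minus : ∀ x ∈ s.pureTop, s.shrunk x ∈ t.minus ↔ x ∈ s.minus
  plusParent : ∀ x ∈ s.pureTop, t.plusParent (s.shrunk x) = s.plusParent x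
  minusParent : ∀ x ∈ s.pureTop, t.minusParent (s.shrunk x) = s.minusParent x

end CherryState

end Blossom

/-!
A cherry blossom is shrunk ear by ear. The part `A` contracted so far starts as the receptacle, and
no mate of a remaining node lies in `A`. The alternating path of a remaining node meets `A` for the
first time through an unmatched edge `vw` with `v` outside `A`; the path that leaves `v` through its
matched edge also returns to `A` through an unmatched edge, and closes up with `vw` to an odd
alternating cycle through the contracted node. Contracting it preserves the invariant. Doing this
inside every supernode and in the current graph refines the laminar family of supernodes to one of
traditional blossoms, and nothing is left to contract in the current graph of a stuck state, which
has no `±`-nodes.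

In a stuck state a plus-node is joined by tight edges to minus-nodes only, and a minus-supernode has
positive dual variable, so equal small steps on all trees are feasible. Minus-nodes cancel against
their mates, hence a dual update increases the dual objective by the sum of its steps. A perfect
matching bounds the dual objective, so the feasible steps form a compact set, and steps with the
largest sum are a dual update that makes progress: a contradiction.
-/

namespace Blossom

/-! ### Laminar families and contraction -/

namespace IsNodeSet

variable {V : Type*} {𝒩 𝒩' : Finset (Finset V)}

theorem subset (h : IsNodeSet 𝒩') (hs : 𝒩 ⊆ 𝒩') : IsNodeSet 𝒩 :=
  ⟨fun u hu => h.1 u (hs hu), fun u hu v hv => h.2 u (hs hu) v (hs hv)⟩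

theorem eq_of_mem (h : IsNodeSet 𝒩) {u v : Finset V} (hu : u ∈ 𝒩) (hv : v ∈ 𝒩) {a : V}
    (hau : a ∈ u) (hav : a ∈ v) : u = v :=
  not_imp_comm.1 (h.2 u hu v hv) (Finset.not_disjoint_iff.2 ⟨a, hau, hav⟩)

end IsNodeSet

section Merge

variable {V : Type*} [DecidableEq V] {C : Finset (Finset V)} {c : Finset V}

theorem mem_merge {v : V} : v ∈ merge C ↔ ∃ c ∈ C, v ∈ c := by
  simp [merge]

theorem subset_merge (hc : c ∈ C) : c ⊆ merge C :=
  fun _ hv => mem_merge.2 ⟨c, hc, hv⟩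

theorem merge_union (C C' : Finset (Finset V)) : merge (C ∪ C') = merge C ∪ merge C' :=
  Finset.union_biUnion

theorem merge_singleton (x : Finset V) : merge {x} = x := by simp [merge]

theorem IsNodeSet.ssubset_merge (h : IsNodeSet C) (hC : 1 < C.card) (hc : c ∈ C) :
    c ⊂ merge C := by
  refine (subset_merge hc).ssubset_of_ne fun heq => ?_
  obtain ⟨d, hd, hdc⟩ := Finset.exists_mem_ne hC c
  obtain ⟨a, ha⟩ := h.1 d hd
  exact hdc (h.eq_of_mem hd hc ha (heq ▸ subset_merge hd ha))

theorem IsNodeSet.one_lt_card_merge (h : IsNodeSet C) (hC : 1 < C.card) :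
    1 < (merge C).card := by
  obtain ⟨c, hc⟩ := Finset.card_pos.1 (zero_lt_one.trans hC)
  exact Nat.lt_of_le_of_lt (Finset.card_pos.2 (h.1 c hc))
    (Finset.card_lt_card (h.ssubset_merge hC hc))

end Merge

section Laminar

variable {V : Type*} [Fintype V] [DecidableEq V] {𝓑 : Finset (Finset V)}
  {P : Finset V → Prop} {B S : Finset V}

theorem mem_nodes : S ∈ nodes 𝓑 ↔ (∃ v, {v} = S) ∨ S ∈ 𝓑 := by
  simp [nodes]

theorem singleton_mem_nodes (v : V) : {v} ∈ nodes 𝓑 := mem_nodes.2 (Or.inl ⟨v, rfl⟩)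

theorem mem_nodes_of_mem (hB : B ∈ 𝓑) : B ∈ nodes 𝓑 := mem_nodes.2 (Or.inr hB)

theorem IsLaminar.nonempty_of_mem_nodes (h : IsLaminar 𝓑) (hS : S ∈ nodes 𝓑) : S.Nonempty := by
  rcases mem_nodes.1 hS with ⟨v, rfl⟩ | hS
  · exact Finset.singleton_nonempty v
  · exact Finset.card_pos.1 (zero_lt_one.trans (h.1 S hS))

theorem IsLaminar.nested (h : IsLaminar 𝓑) {A : Finset V} (hA : A ∈ nodes 𝓑)
    (hB : B ∈ nodes 𝓑) : A ⊆ B ∨ B ⊆ A ∨ Disjoint A B := by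
  rcases mem_nodes.1 hA with ⟨v, rfl⟩ | hA'
  · rw [Finset.singleton_subset_iff, Finset.disjoint_singleton_left]
    tauto
  rcases mem_nodes.1 hB with ⟨v, rfl⟩ | hB'
  · rw [Finset.singleton_subset_iff, Finset.disjoint_singleton_right]
    tauto
  · exact h.2 A hA' B hB'

open Classical in
/-- The maximal nodes with the property `P`: a common generalization of the nodes of the current
graph and of the elements of a supernode. -/
noncomputable def maxNodes (𝓑 : Finset (Finset V)) (P : Finset V → Prop) : Finset (Finset V) :=
  (nodes 𝓑).filter fun S => P S ∧ ∀ T ∈ nodes 𝓑, S ⊂ T → ¬ P T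

theorem mem_maxNodes :
    S ∈ maxNodes 𝓑 P ↔ S ∈ nodes 𝓑 ∧ P S ∧ ∀ T ∈ nodes 𝓑, S ⊂ T → ¬ P T := by
  simp [maxNodes]

theorem maxNodes_subset_nodes : maxNodes 𝓑 P ⊆ nodes 𝓑 := fun _ hS => (mem_maxNodes.1 hS).1

theorem topNodes_eq_maxNodes : topNodes 𝓑 = maxNodes 𝓑 fun _ => True := by
  ext S
  simp [mem_maxNodes, topNodes]

theorem children_eq_maxNodes (B : Finset V) : children 𝓑 B = maxNodes 𝓑 (· ⊂ B) := by
  ext S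
  simp [mem_maxNodes, children]

theorem exists_maxNodes_superset (hS : S ∈ nodes 𝓑) (hP : P S) :
    ∃ T ∈ maxNodes 𝓑 P, S ⊆ T := by
  classical
  obtain ⟨T, hST, hT⟩ := ((nodes 𝓑).filter P).exists_le_maximal (a := S) (by simp [hS, hP])
  obtain ⟨hT1, hT2⟩ := Finset.mem_filter.1 hT.prop
  exact ⟨T, mem_maxNodes.2 ⟨hT1, hT2, fun T' hT' hlt hP' =>
    hT.not_gt (Finset.mem_filter.2 ⟨hT', hP'⟩) hlt⟩, hST⟩

theorem exists_mem_topNodes (v : V) : ∃ A ∈ topNodes 𝓑, v ∈ A := by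
  obtain ⟨A, hA, hv⟩ := exists_maxNodes_superset (𝓑 := 𝓑) (P := fun _ => True)
    (singleton_mem_nodes v) trivial
  exact ⟨A, topNodes_eq_maxNodes (𝓑 := 𝓑) ▸ hA, Finset.singleton_subset_iff.1 hv⟩

theorem merge_children (hB : 1 < B.card) : merge (children 𝓑 B) = B := by
  ext v
  rw [mem_merge, children_eq_maxNodes]
  constructor
  · rintro ⟨c, hc, hv⟩
    exact (mem_maxNodes.1 hc).2.1.subset hv
  · intro hv
    have hvB : {v} ⊂ B := by
      refine (Finset.singleton_subset_iff.2 hv).ssubset_of_ne ?_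
      rintro rfl
      exact hB.ne' (Finset.card_singleton v)
    obtain ⟨T, hT, hvT⟩ := exists_maxNodes_superset (𝓑 := 𝓑) (P := (· ⊂ B))
      (singleton_mem_nodes v) hvB
    exact ⟨T, hT, Finset.singleton_subset_iff.1 hvT⟩

theorem IsLaminar.isNodeSet_maxNodes (h : IsLaminar 𝓑) (P : Finset V → Prop) :
    IsNodeSet (maxNodes 𝓑 P) := by
  refine ⟨fun u hu => h.nonempty_of_mem_nodes (maxNodes_subset_nodes hu),
    fun u hu v hv huv => ?_⟩
  obtain ⟨hu1, hu2, hu3⟩ := mem_maxNodes.1 hu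
  obtain ⟨hv1, hv2, hv3⟩ := mem_maxNodes.1 hv
  rcases h.nested hu1 hv1 with huv' | hvu | hd
  · exact (hu3 v hv1 (huv'.ssubset_of_ne huv) hv2).elim
  · exact (hv3 u hu1 (hvu.ssubset_of_ne huv.symm) hu2).elim
  · exact hd

theorem IsLaminar.isNodeSet_topNodes (h : IsLaminar 𝓑) : IsNodeSet (topNodes 𝓑) :=
  topNodes_eq_maxNodes (𝓑 := 𝓑) ▸ h.isNodeSet_maxNodes _

theorem IsLaminar.isNodeSet_children (h : IsLaminar 𝓑) (B : Finset V) :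
    IsNodeSet (children 𝓑 B) :=
  children_eq_maxNodes (𝓑 := 𝓑) B ▸ h.isNodeSet_maxNodes _

/-- The sets with the property `P` live in one contracted graph: they are closed under subsets,
and a node outside of `P` that contains one of them contains all. This axiomatizes what the two
properties "any set" and "proper subset of the supernode `B`" have in common. -/
structure IsLevel (𝓑 : Finset (Finset V)) (P : Finset V → Prop) : Prop where
  down : ∀ S T, S ⊆ T → P T → P S
  above : ∀ A ∈ nodes 𝓑, ∀ S, S.Nonempty → P S → S ⊆ A → ¬ P A → ∀ S', P S' → S' ⊆ A

theorem isLevel_true : IsLevel 𝓑 fun _ => True :=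
  ⟨fun _ _ _ _ => trivial, fun _ _ _ _ _ _ h => (h trivial).elim⟩

theorem IsLaminar.isLevel_ssubset (h : IsLaminar 𝓑) (hB : B ∈ nodes 𝓑) :
    IsLevel 𝓑 (· ⊂ B) := by
  refine ⟨fun S T hST hT => hST.trans_ssubset hT, fun A hA S hne hS hSA hAB S' hS' => ?_⟩
  refine hS'.subset.trans ?_
  rcases h.nested hA hB with hAB' | hBA | hd
  · exact (eq_or_ssubset_of_subset hAB').elim (fun heq => heq.symm.subset) (absurd · hAB)
  · exact hBA
  · exact (hne.ne_empty ((Finset.disjoint_self_iff_empty S).1 (hd.mono hSA hS.subset))).elim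

end Laminar

section Insert

variable {V : Type*} [Fintype V] [DecidableEq V] {𝓑 C : Finset (Finset V)} {P : Finset V → Prop}
  {A Y : Finset V}

theorem mem_nodes_insert {S : Finset V} : S ∈ nodes (insert Y 𝓑) ↔ S = Y ∨ S ∈ nodes 𝓑 := by
  simp only [mem_nodes, Finset.mem_insert]
  tauto

theorem not_of_merge_ssubset (hC : C ⊆ maxNodes 𝓑 P) (hne : C.Nonempty)
    (hA : A ∈ nodes 𝓑) (hlt : merge C ⊂ A) : ¬ P A := by
  obtain ⟨c, hc⟩ := hne
  exact (mem_maxNodes.1 (hC hc)).2.2 A hA ((subset_merge hc).trans_ssubset hlt)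

theorem IsLaminar.nested_merge (h : IsLaminar 𝓑) (hP : IsLevel 𝓑 P) (hC : C ⊆ maxNodes 𝓑 P)
    (hPC : P (merge C)) (hA : A ∈ nodes 𝓑) :
    (∃ c ∈ C, A ⊆ c) ∨ (merge C ⊆ A ∧ ¬ P A) ∨ Disjoint A (merge C) := by
  by_cases hd : Disjoint A (merge C)
  · exact Or.inr (Or.inr hd)
  obtain ⟨a, ha, haC⟩ := Finset.not_disjoint_iff.1 hd
  obtain ⟨c, hc, hac⟩ := mem_merge.1 haC
  obtain ⟨hc1, hc2, hc3⟩ := mem_maxNodes.1 (hC hc)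
  by_cases hAc : A ⊆ c
  · exact Or.inl ⟨c, hc, hAc⟩
  have hcA : c ⊂ A := by
    rcases h.nested hA hc1 with h1 | h1 | h1
    · exact (hAc h1).elim
    · exact ⟨h1, hAc⟩
    · exact (Finset.disjoint_left.1 h1 ha hac).elim
  have hnP := hc3 A hA hcA
  exact Or.inr (Or.inl
    ⟨hP.above A hA c (h.nonempty_of_mem_nodes hc1) hc2 hcA.subset hnP _ hPC, hnP⟩)

theorem IsLaminar.insert_merge (h : IsLaminar 𝓑) (hP : IsLevel 𝓑 P) (hC : C ⊆ maxNodes 𝓑 P)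
    (hPC : P (merge C)) (hcard : 1 < C.card) : IsLaminar (insert (merge C) 𝓑) := by
  have nested : ∀ A ∈ 𝓑, A ⊆ merge C ∨ merge C ⊆ A ∨ Disjoint A (merge C) := by
    intro A hA
    rcases h.nested_merge hP hC hPC (mem_nodes_of_mem hA) with ⟨c, hc, h1⟩ | h1 | h1
    · exact Or.inl (h1.trans (subset_merge hc))
    · exact Or.inr (Or.inl h1.1)
    · exact Or.inr (Or.inr h1)
  refine ⟨fun B hB => ?_, fun A hA B hB => ?_⟩
  · rcases Finset.mem_insert.1 hB with rfl | hB
    · exact ((h.isNodeSet_maxNodes P).subset hC).one_lt_card_merge hcard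
    · exact h.1 B hB
  · rcases Finset.mem_insert.1 hA with rfl | hA <;> rcases Finset.mem_insert.1 hB with rfl | hB
    · exact Or.inl subset_rfl
    · rcases nested B hB with h1 | h1 | h1
      · exact Or.inr (Or.inl h1)
      · exact Or.inl h1
      · exact Or.inr (Or.inr h1.symm)
    · exact nested A hA
    · exact h.2 A hA B hB

theorem IsLaminar.maxNodes_insert_merge (h : IsLaminar 𝓑) (hC : C ⊆ maxNodes 𝓑 P)
    (hPC : P (merge C)) (hcard : 1 < C.card) :
    maxNodes (insert (merge C) 𝓑) P = contract (maxNodes 𝓑 P) C := by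
  have hN := h.isNodeSet_maxNodes P
  have hne : C.Nonempty := Finset.card_pos.1 (zero_lt_one.trans hcard)
  ext S
  simp only [contract, Finset.mem_insert, Finset.mem_sdiff, mem_maxNodes, mem_nodes_insert,
    forall_eq_or_imp]
  constructor
  · rintro ⟨rfl | hS, hPS, hSC, hmax⟩
    · exact Or.inl rfl
    · exact Or.inr ⟨⟨hS, hPS, hmax⟩, fun hS' => hSC ((hN.subset hC).ssubset_merge hcard hS') hPC⟩
  · rintro (rfl | ⟨⟨hS, hPS, hmax⟩, hSC⟩)
    · exact ⟨Or.inl rfl, hPC, fun hlt => (hlt.ne rfl).elim,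
        fun T hT hlt => not_of_merge_ssubset hC hne hT hlt⟩
    · refine ⟨Or.inr hS, hPS, fun hlt => ?_, hmax⟩
      obtain ⟨a, ha⟩ := h.nonempty_of_mem_nodes hS
      obtain ⟨c, hc, hac⟩ := mem_merge.1 (hlt.subset ha)
      exact (hSC (hN.eq_of_mem (hC hc) (mem_maxNodes.2 ⟨hS, hPS, hmax⟩) hac ha ▸ hc)).elim

theorem IsLaminar.children_insert_merge (h : IsLaminar 𝓑) (hP : IsLevel 𝓑 P)
    (hC : C ⊆ maxNodes 𝓑 P) (hPC : P (merge C)) (hcard : 1 < C.card) :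
    children (insert (merge C) 𝓑) (merge C) = C := by
  have hlt : ∀ c ∈ C, c ⊂ merge C := fun c hc =>
    ((h.isNodeSet_maxNodes P).subset hC).ssubset_merge hcard hc
  ext S
  simp only [children_eq_maxNodes, mem_maxNodes, mem_nodes_insert, forall_eq_or_imp]
  constructor
  · rintro ⟨rfl | hS, hSC, -, hmax⟩
    · exact (hSC.ne rfl).elim
    rcases h.nested_merge hP hC hPC hS with ⟨c, hc, hSc⟩ | ⟨hCS, -⟩ | hd
    · rcases eq_or_ssubset_of_subset hSc with rfl | hSc
      · exact hc
      · exact (hmax c (maxNodes_subset_nodes (hC hc)) hSc (hlt c hc)).elim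
    · exact (hSC.not_subset hCS).elim
    · exact ((h.nonempty_of_mem_nodes hS).ne_empty
        ((Finset.disjoint_self_iff_empty S).1 (hd.mono_right hSC.subset))).elim
  · intro hS
    obtain ⟨hS1, -, hS3⟩ := mem_maxNodes.1 (hC hS)
    exact ⟨Or.inr hS1, hlt S hS, fun _ h' => h'.ne rfl,
      fun T hT hST hTC => hS3 T hT hST (hP.down _ _ hTC.subset hPC)⟩

theorem maxNodes_insert_of_not_maximal (hY : P Y → ∃ B ∈ nodes 𝓑, Y ⊂ B ∧ P B) :
    maxNodes (insert Y 𝓑) P = maxNodes 𝓑 P := by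
  ext S
  simp only [mem_maxNodes, mem_nodes_insert, forall_eq_or_imp]
  constructor
  · rintro ⟨rfl | hS, hPS, -, hmax⟩
    · obtain ⟨B, hB, hlt, hPB⟩ := hY hPS
      exact (hmax B hB hlt hPB).elim
    · exact ⟨hS, hPS, hmax⟩
  · rintro ⟨hS, hPS, hmax⟩
    refine ⟨Or.inr hS, hPS, fun hlt hPY => ?_, hmax⟩
    obtain ⟨B, hB, hlt', hPB⟩ := hY hPY
    exact hmax B hB (hlt.trans hlt') hPB

end Insert

/-! ### Alternating paths -/

namespace AltData

variable {V : Type*} {D : AltData V} {H : SimpleGraph V} {𝒩 : Finset (Finset V)}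
  {v v' : Finset V} {b : Bool} {l l' : List (Finset V)}

theorem Mates.symm (h : D.Mates v v') : D.Mates v' v := by
  obtain ⟨hne, a, ha, b, hb, hM⟩ := h
  exact ⟨hne.symm, b, hb, a, ha, by rwa [Sym2.eq_swap]⟩

theorem IsMatching.mates_unique (h : D.IsMatching H 𝒩) (hN : IsNodeSet 𝒩) {u : Finset V}
    (hu : u ∈ 𝒩) (hv : v ∈ 𝒩) (hv' : v' ∈ 𝒩) (h1 : D.Mates u v) (h2 : D.Mates u v') :
    v = v' := by
  obtain ⟨hne, a, ha, b, hb, hM⟩ := h1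
  obtain ⟨hne', a', ha', b', hb', hM'⟩ := h2
  obtain ⟨-, rfl⟩ := h.2 u hu v hv v' hv' hne hne' a ha b hb a' ha' b' hb' hM hM'
  exact hN.eq_of_mem hv hv' hb hb'

theorem AltPath.mem (h : D.AltPath 𝒩 v b l) : v ∈ 𝒩 := by
  cases h with
  | root _ hr => exact hr.1
  | plus _ _ _ hv => exact hv
  | minus _ _ _ hv => exact hv

theorem AltPath.exists_eq_cons (h : D.AltPath 𝒩 v b l) : ∃ l', l = v :: l' := by
  cases h <;> exact ⟨_, rfl⟩

theorem IsForest.mem_plus_of_altPath (hF : D.IsForest H 𝒩) (h : D.AltPath 𝒩 v true l) :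
    v ∈ D.plus := by
  cases h with
  | root _ hr => exact (hF.root v hr).1
  | plus _ _ _ _ hp => exact hp

theorem AltPath.mem_minus (h : D.AltPath 𝒩 v false l) : v ∈ D.minus := by
  cases h with
  | minus _ _ _ _ hm => exact hm

theorem AltPath.deterministic (hN : IsNodeSet 𝒩) (h : D.AltPath 𝒩 v b l)
    (h' : D.AltPath 𝒩 v b l') : l = l' := by
  induction h generalizing l' with
  | root r hr =>
    cases h' with
    | root => rfl
    | plus _ _ _ _ _ hr' => exact (hr' hr).elim
  | plus v z l _ _ hr hz hz2 _ ih =>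
    cases h' with
    | root _ hr' => exact (hr hr').elim
    | plus _ z' l' _ _ _ hz' hz2' hl' =>
      obtain rfl := hN.eq_of_mem hz hz' hz2 hz2'
      rw [ih hl']
  | minus v z l _ _ hz hz2 _ ih =>
    cases h' with
    | minus _ z' l' _ _ hz' hz2' hl' =>
      obtain rfl := hN.eq_of_mem hz hz' hz2 hz2'
      rw [ih hl']

theorem IsForest.mates_plusParent (hF : D.IsForest H 𝒩) (hN : IsNodeSet 𝒩) (hv : v ∈ 𝒩)
    (hp : v ∈ D.plus) (hr : ¬ D.IsRoot 𝒩 v) (hv' : v' ∈ 𝒩) (h : (D.plusParent v).2 ∈ v') :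
    D.Mates v v' := by
  obtain ⟨h1, ⟨z, hz, hzv, hz2⟩, -, hM⟩ := hF.plusParent v hv hp hr
  obtain rfl := hN.eq_of_mem hz hv' hz2 h
  exact ⟨hzv.symm, _, h1, _, h, hM⟩

theorem IsForest.exists_altPath_cons_of_mates (hF : D.IsForest H 𝒩) (hN : IsNodeSet 𝒩)
    (hv : v ∈ 𝒩) (hp : v ∈ D.plus) (hv' : v' ∈ 𝒩) (h : D.Mates v v') :
    ∃ l, D.AltPath 𝒩 v true (v :: l) ∧ D.AltPath 𝒩 v' false l := by
  obtain ⟨l, hl, -⟩ := hF.plusPath v hv hp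
  cases hl with
  | root _ hr => exact (hr.2 v' hv' h).elim
  | plus _ z l _ _ hr hz hz2 hl =>
    obtain rfl := hF.matching.mates_unique hN hv hz hv' (hF.mates_plusParent hN hv hp hr hz hz2) h
    exact ⟨l, .plus v z l hv hp hr hz hz2 hl, hl⟩

end AltData

theorem eq_of_forall_mem_takeWhile_ne {α : Type*} [DecidableEq α] {p : α → Prop} {l : List α}
    {r r' : α} (hr : ¬ p r) (hr' : ¬ p r') (hm : r ∈ l) (hm' : r' ∈ l)
    (h : ∀ v ∈ l.takeWhile (fun v => v ≠ r), p v)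
    (h' : ∀ v ∈ l.takeWhile (fun v => v ≠ r'), p v) : r = r' := by
  induction l with
  | nil => simp at hm
  | cons a l ih =>
    rw [List.takeWhile_cons] at h h'
    by_cases ha : a = r <;> by_cases ha' : a = r' <;> grind

namespace CherryData

open AltData

variable {V : Type*} [DecidableEq V] {D : CherryData V} {H : SimpleGraph V}
  {𝒩 : Finset (Finset V)} {x v v' : Finset V}

theorem mem_cherryBlossom : v ∈ D.cherryBlossom 𝒩 x ↔
    v = x ∨ v ∈ 𝒩 ∧ v ∈ D.plus ∧ v ∈ D.minus ∧ D.receptacle v = x := by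
  simp [cherryBlossom]

theorem self_mem_cherryBlossom : x ∈ D.cherryBlossom 𝒩 x := Finset.mem_insert_self _ _

theorem cherryBlossom_subset (hx : x ∈ 𝒩) : D.cherryBlossom 𝒩 x ⊆ 𝒩 :=
  Finset.insert_subset hx (Finset.filter_subset _ _)

/-- Both `v` and its successor have as receptacle the first node on their paths that is not a
`±`-node. -/
theorem IsCherryForest.mem_cherryBlossom_receptacle_of_altPath (hF : D.IsCherryForest H 𝒩)
    {b b' : Bool} {l : List (Finset V)} (hp : v ∈ D.plus) (hm : v ∈ D.minus)
    (h : D.AltPath 𝒩 v b (v :: l)) (hl : D.AltPath 𝒩 v' b' l) :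
    v' ∈ D.cherryBlossom 𝒩 (D.receptacle v) := by
  obtain ⟨h1, h2⟩ := hF.receptacle_path v h.mem hp hm b _ h
  obtain ⟨-, -, hrm⟩ := hF.receptacle_plus v h.mem hp hm
  have hne : v ≠ D.receptacle v := fun h3 => hrm (h3 ▸ hm)
  have hmem : D.receptacle v ∈ l := (List.mem_cons.1 h1).resolve_left hne.symm
  rw [List.takeWhile_cons_of_pos (by simpa using hne)] at h2
  have hall : ∀ u ∈ l.takeWhile (fun u => u ≠ D.receptacle v), u ∈ D.plus ∧ u ∈ D.minus :=
    fun u hu => h2 u (List.mem_cons_of_mem _ hu)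
  by_cases hv' : v' = D.receptacle v
  · exact hv' ▸ self_mem_cherryBlossom
  obtain ⟨l', rfl⟩ := hl.exists_eq_cons
  obtain ⟨hp', hm'⟩ := hall v' (by simp [hv'])
  obtain ⟨-, -, hrm'⟩ := hF.receptacle_plus v' hl.mem hp' hm'
  obtain ⟨hmem', hall'⟩ := hF.receptacle_path v' hl.mem hp' hm' b' _ hl
  exact mem_cherryBlossom.2 (Or.inr ⟨hl.mem, hp', hm',
    eq_of_forall_mem_takeWhile_ne (p := fun u => u ∈ D.plus ∧ u ∈ D.minus)
      (fun h => hrm' h.2) (fun h => hrm h.2) hmem' hmem hall' hall⟩)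

theorem IsCherryForest.mate_plusMinus (hF : D.IsCherryForest H 𝒩) (hN : IsNodeSet 𝒩)
    (hv : v ∈ 𝒩) (hp : v ∈ D.plus) (hm : v ∈ D.minus) (hv' : v' ∈ 𝒩) (h : D.Mates v v') :
    v' ∈ D.plus ∧ v' ∈ D.minus ∧ D.receptacle v' = D.receptacle v := by
  obtain ⟨l, hvl, hl⟩ := hF.exists_altPath_cons_of_mates hN hv hp hv' h
  rcases mem_cherryBlossom.1 (hF.mem_cherryBlossom_receptacle_of_altPath hp hm hvl hl) with
    hrec | hpm
  · exact ((hF.receptacle_plus v hv hp hm).2.2 (hrec ▸ hl.mem_minus)).elim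
  · exact hpm.2

theorem IsCherryForest.not_plusMinus_of_mates (hF : D.IsCherryForest H 𝒩) (hN : IsNodeSet 𝒩)
    (hv : v ∈ 𝒩) (h : ¬ (v ∈ D.plus ∧ v ∈ D.minus)) (hv' : v' ∈ 𝒩) (hM : D.Mates v v') :
    ¬ (v' ∈ D.plus ∧ v' ∈ D.minus) := fun h' => by
  obtain ⟨hp, hm, -⟩ := hF.mate_plusMinus hN hv' h'.1 h'.2 hv hM.symm
  exact h ⟨hp, hm⟩

end CherryData

/-! ### Ears and shrinking -/

section Ears

variable {V : Type*} {H : SimpleGraph V} {M : Finset (Sym2 V)}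
  {R R' A 𝒩 : Finset (Finset V)} {b : Bool} {n k : ℕ} {p : ℕ → Finset V} {q : ℕ → V × V}
  {a v : Finset V}

/-- An ear on `A`: an alternating path from `p 0` through distinct nodes `p 0, …, p (n - 1)` of `R`
to the node `p n` of `A`. Its edge `q i` leads from `p i` to `p (i + 1)`; the first edge is matched
iff `b = true`, and the last edge is unmatched. -/
structure IsEar (H : SimpleGraph V) (M : Finset (Sym2 V)) (R A : Finset (Finset V)) (b : Bool)
    (n : ℕ) (p : ℕ → Finset V) (q : ℕ → V × V) : Prop where
  pos : 0 < n
  mem : ∀ i < n, p i ∈ R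
  end_mem : p n ∈ A
  inj : ∀ i < n, ∀ j < n, p i = p j → i = j
  edge : ∀ i < n, (q i).1 ∈ p i ∧ (q i).2 ∈ p (i + 1) ∧ H.Adj (q i).1 (q i).2
  matched : ∀ i < n, (s((q i).1, (q i).2) ∈ M ↔ (Even i ↔ b = true))
  parity : Even n ↔ b = true

theorem IsEar.mono (h : IsEar H M R A b n p q) (hR : R ⊆ R') : IsEar H M R' A b n p q :=
  { h with mem := fun i hi => hR (h.mem i hi) }

theorem IsEar.single {v' : Finset V} {e : V × V} (hv : v ∈ R) (hv' : v' ∈ A) (h1 : e.1 ∈ v)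
    (h2 : e.2 ∈ v') (he : H.Adj e.1 e.2) (hM : s(e.1, e.2) ∉ M) :
    IsEar H M R A false 1 (fun i => i.casesOn v fun _ => v') fun _ => e where
  pos := one_pos
  mem i hi := by obtain rfl := Nat.lt_one_iff.1 hi; exact hv
  end_mem := hv'
  inj i hi j hj _ := by omega
  edge i hi := by obtain rfl := Nat.lt_one_iff.1 hi; exact ⟨h1, h2, he⟩
  matched i hi := by obtain rfl := Nat.lt_one_iff.1 hi; simpa using hM
  parity := by simp

theorem IsEar.cons [DecidableEq V] (h : IsEar H M R A (!b) n p q) {e : V × V} (hv : v ∉ R)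
    (h1 : e.1 ∈ v) (h2 : e.2 ∈ p 0) (he : H.Adj e.1 e.2) (hM : s(e.1, e.2) ∈ M ↔ b = true) :
    IsEar H M (insert v R) A b (n + 1) (fun i => i.casesOn v p) (fun i => i.casesOn e q) where
  pos := n.succ_pos
  mem
    | 0, _ => Finset.mem_insert_self _ _
    | i + 1, hi => Finset.mem_insert_of_mem (h.mem i (by omega))
  end_mem := h.end_mem
  inj
    | 0, _, 0, _, _ => rfl
    | 0, _, j + 1, hj, (hij : v = p j) => (hv (hij ▸ h.mem j (by omega))).elim
    | i + 1, hi, 0, _, (hij : p i = v) => (hv (hij ▸ h.mem i (by omega))).elim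
    | i + 1, hi, j + 1, hj, hij => by rw [h.inj i (by omega) j (by omega) hij]
  edge
    | 0, _ => ⟨h1, h2, he⟩
    | i + 1, hi => h.edge i (by omega)
  matched
    | 0, _ => by simpa using hM
    | i + 1, hi => by
      have := h.matched i (by omega)
      cases b <;> simpa [Nat.even_add_one] using this
  parity := by
    have := h.parity
    cases b <;> simpa [Nat.even_add_one] using this

theorem IsEar.exists_unmatched_edge (h : IsEar H M R A b n p q) :
    ∃ v ∈ R, ∃ w ∈ A, ∃ e : V × V, e.1 ∈ v ∧ e.2 ∈ w ∧ H.Adj e.1 e.2 ∧ s(e.1, e.2) ∉ M := by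
  obtain ⟨m, rfl⟩ := Nat.exists_eq_add_of_lt h.pos
  obtain ⟨h1, h2, he⟩ := h.edge (0 + m) (by omega)
  refine ⟨_, h.mem (0 + m) (by omega), _, h.end_mem, _, h1, h2, he, fun hM => ?_⟩
  have hm := (h.matched (0 + m) (by omega)).1 hM
  have hp := h.parity
  rw [Nat.even_add_one] at hp
  tauto

theorem IsEar.exists_mates {D : AltData V} (h : IsEar H D.M R A true n p q) {i : ℕ} (hi : i < n) :
    ∃ j < n, D.Mates (p i) (p j) := by
  have hn : Even n := h.parity.2 rfl
  have hmates : ∀ i, Even i → i + 1 < n → D.Mates (p i) (p (i + 1)) := fun i hi hlt => by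
    obtain ⟨h1, h2, -⟩ := h.edge i (by omega)
    refine ⟨fun heq => ?_, _, h1, _, h2, (h.matched i (by omega)).2 (by simpa using hi)⟩
    have := h.inj i (by omega) (i + 1) hlt heq
    omega
  rcases Nat.even_or_odd i with he | ⟨r, rfl⟩
  · have hlt : i + 1 < n := by grind
    exact ⟨i + 1, hlt, hmates i he hlt⟩
  · exact ⟨2 * r, by omega, (hmates (2 * r) (even_two_mul r) hi).symm⟩

theorem isOddCycle_of_nat (hk : 1 ≤ k) (c : ℕ → Finset V) (e : ℕ → V × V)
    (hmem : ∀ i < 2 * k + 1, c i ∈ 𝒩)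
    (hinj : ∀ i < 2 * k + 1, ∀ j < 2 * k + 1, c i = c j → i = j)
    (he : ∀ i < 2 * k + 1, (e i).1 ∈ c i ∧ H.Adj (e i).1 (e i).2 ∧
      (s((e i).1, (e i).2) ∈ M ↔ Odd i))
    (hnext : ∀ i < 2 * k, (e i).2 ∈ c (i + 1)) (hlast : (e (2 * k)).2 ∈ c 0) :
    IsOddCycle H M 𝒩 k (fun i => c i) (fun i => e i) where
  pos := hk
  mem i := hmem i i.2
  inj i j hij := Fin.ext (hinj i i.2 j j.2 hij)
  edge i := by
    refine ⟨(he i i.2).1, ?_, (he i i.2).2.1⟩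
    rw [Fin.val_add_one]
    split_ifs with hi
    · rw [hi]; exact hlast
    · exact hnext i (by have := i.2; have : (i : ℕ) ≠ 2 * k := fun h' => hi (Fin.ext h'); omega)
  alternating i := (he i i.2).2.2

theorem IsEar.exists_isOddCycle [DecidableEq V] (h : IsEar H M R A true n p q) (ha : a ∉ R)
    (hpa : p n ⊆ a) {e : V × V} (h1 : e.1 ∈ a) (h2 : e.2 ∈ p 0) (he : H.Adj e.1 e.2)
    (hM : s(e.1, e.2) ∉ M) :
    ∃ (k : ℕ) (c : Fin (2 * k + 1) → Finset V) (f : Fin (2 * k + 1) → V × V),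
      IsOddCycle H M (insert a R) k c f ∧ c 0 = a ∧
        Finset.univ.image c = insert a ((Finset.range n).image p) := by
  obtain ⟨k, rfl⟩ := (h.parity.2 rfl).two_dvd
  have hk : 1 ≤ k := by have := h.pos; omega
  let c : ℕ → Finset V := fun i => i.casesOn a p
  refine ⟨k, fun i => c i, fun i => Nat.casesOn (i : ℕ) e q, isOddCycle_of_nat hk c
    (fun i => i.casesOn e q) ?_ ?_ ?_ ?_ ?_, rfl, ?_⟩
  · rintro (_ | i) hi
    exacts [Finset.mem_insert_self _ _, Finset.mem_insert_of_mem (h.mem i (by omega))]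
  · rintro (_ | i) hi (_ | j) hj hij
    · rfl
    · exact (ha (by change a = p j at hij; exact hij ▸ h.mem j (by omega))).elim
    · exact (ha (by change p i = a at hij; exact hij ▸ h.mem i (by omega))).elim
    · rw [h.inj i (by omega) j (by omega) hij]
  · rintro (_ | i) hi
    · exact ⟨h1, he, by simpa using hM⟩
    · obtain ⟨h3, -, h4⟩ := h.edge i (by omega)
      exact ⟨h3, h4, by simpa [Nat.odd_add_one] using h.matched i (by omega)⟩
  · rintro (_ | i) hi
    exacts [h2, (h.edge i (by omega)).2.1]
  · obtain ⟨j, hj⟩ := Nat.exists_eq_add_of_lt h.pos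
    rw [hj] at hpa ⊢
    exact hpa (h.edge (0 + j) (by omega)).2.1
  · ext v
    simp only [c, Finset.mem_image, Finset.mem_univ, true_and, Finset.mem_insert, Finset.mem_range]
    constructor
    · rintro ⟨⟨_ | i, hi⟩, rfl⟩
      exacts [Or.inl rfl, Or.inr ⟨i, by omega, rfl⟩]
    · rintro (rfl | ⟨i, hi, rfl⟩)
      exacts [⟨⟨0, by omega⟩, rfl⟩, ⟨⟨i + 1, by omega⟩, rfl⟩]

end Ears

section Shrink

variable {V : Type*} [DecidableEq V] {H : SimpleGraph V} {M : Finset (Sym2 V)}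
  {x y : Finset V} {𝒩 𝒩' 𝒪 A B C : Finset (Finset V)}

theorem OddCycleShrink.of_subset (h : OddCycleShrink H M x 𝒩 𝒩') (hy : y ⊆ x) :
    OddCycleShrink H M y 𝒩 𝒩' := by
  obtain ⟨k, c, e, hc, hx, h𝒩⟩ := h
  exact ⟨k, c, e, hc, hy.trans hx, h𝒩⟩

theorem OddCycleShrink.union (h : OddCycleShrink H M x 𝒩 𝒩') (hd : Disjoint 𝒪 𝒩) :
    OddCycleShrink H M x (𝒪 ∪ 𝒩) (𝒪 ∪ 𝒩') := by
  obtain ⟨k, c, e, hc, hx, rfl⟩ := h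
  refine ⟨k, c, e, ⟨hc.pos, fun i => Finset.mem_union_right _ (hc.mem i), hc.inj, hc.edge,
    hc.alternating⟩, hx, ?_⟩
  have himg : Disjoint 𝒪 (Finset.univ.image c) :=
    hd.mono_right (Finset.image_subset_iff.2 fun i _ => hc.mem i)
  rw [contract, contract, Finset.union_sdiff_distrib, Finset.sdiff_eq_self_of_disjoint himg,
    Finset.union_insert]

theorem OddCycleShrink.forall_nonempty_and_disjoint (h : OddCycleShrink H M x 𝒩 𝒩')
    {o : Finset V} (h𝒩 : ∀ u ∈ 𝒩, u.Nonempty ∧ Disjoint o u) :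
    ∀ u ∈ 𝒩', u.Nonempty ∧ Disjoint o u := by
  obtain ⟨k, c, e, hc, -, rfl⟩ := h
  intro u hu
  rcases Finset.mem_insert.1 hu with rfl | hu
  · refine ⟨(h𝒩 _ (hc.mem 0)).1.mono (subset_merge (Finset.mem_image_of_mem c (Finset.mem_univ 0))),
      ?_⟩
    rw [merge, Finset.disjoint_biUnion_right]
    exact Finset.forall_mem_image.2 fun i _ => (h𝒩 _ (hc.mem i)).2
  · exact h𝒩 u (Finset.mem_sdiff.1 hu).1

theorem reflTransGen_oddCycleShrink_union
    (h : Relation.ReflTransGen (OddCycleShrink H M x) 𝒩 𝒩')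
    (h𝒩 : ∀ o ∈ 𝒪, ∀ u ∈ 𝒩, u.Nonempty ∧ Disjoint o u) :
    Relation.ReflTransGen (OddCycleShrink H M x) (𝒪 ∪ 𝒩) (𝒪 ∪ 𝒩') := by
  induction h using Relation.ReflTransGen.head_induction_on with
  | refl => exact .refl
  | head hstep _ ih =>
    refine .head (hstep.union ?_) (ih fun o ho => hstep.forall_nonempty_and_disjoint (h𝒩 o ho))
    refine Finset.disjoint_left.2 fun u huO hu => ?_
    obtain ⟨hne, hd⟩ := h𝒩 u huO u hu
    exact hne.ne_empty (disjoint_self.1 hd)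

theorem contract_insert_merge (hA : merge A ∉ C \ A) :
    contract (insert (merge A) (C \ A)) (insert (merge A) B) =
      insert (merge (A ∪ B)) (C \ (A ∪ B)) := by
  have h1 : merge (insert (merge A) B) = merge (A ∪ B) := by
    rw [merge_union, Finset.insert_eq, merge_union, merge_singleton]
  rw [contract, h1, Finset.insert_sdiff_insert, ← Finset.erase_eq_of_notMem hA]
  grind

end Shrink

namespace CherryData

open AltData

variable {V : Type*} [DecidableEq V] {D : CherryData V} {H : SimpleGraph V}
  {𝒩 A : Finset (Finset V)} {x v : Finset V} {b : Bool} {l : List (Finset V)}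

theorem IsCherryForest.exists_isEar (hF : D.IsCherryForest H 𝒩) (hN : IsNodeSet 𝒩) (hxA : x ∈ A)
    (hA : ∀ u ∈ D.cherryBlossom 𝒩 x \ A, ∀ v ∈ 𝒩, D.Mates u v → v ∉ A)
    (h : D.AltPath 𝒩 v b l) (hl : l.Nodup) (hv : v ∈ D.cherryBlossom 𝒩 x \ A) :
    ∃ n p q, IsEar H D.M {u ∈ D.cherryBlossom 𝒩 x \ A | u ∈ l} A b n p q ∧ p 0 = v := by
  have plusMinus : ∀ {u}, u ∈ D.cherryBlossom 𝒩 x \ A →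
      u ∈ D.plus ∧ u ∈ D.minus ∧ D.receptacle u = x := by
    intro u hu
    obtain ⟨huC, huA⟩ := Finset.mem_sdiff.1 hu
    rcases mem_cherryBlossom.1 huC with rfl | hpm
    exacts [(huA hxA).elim, hpm.2]
  have cons_subset : ∀ {u : Finset V} {l}, u ∈ D.cherryBlossom 𝒩 x \ A →
      insert u {w ∈ D.cherryBlossom 𝒩 x \ A | w ∈ l} ⊆
        {w ∈ D.cherryBlossom 𝒩 x \ A | w ∈ u :: l} := by
    grind
  induction h with
  | root r hr => exact ((hF.root r hr).2 (plusMinus hv).2.1).elim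
  | plus v v' l hv1 hp hr hv' h2 hl' ih =>
    obtain ⟨-, hm, hrec⟩ := plusMinus hv
    have hmate := hF.mates_plusParent hN hv1 hp hr hv' h2
    obtain ⟨h1, -, hadj, hM⟩ := hF.plusParent v hv1 hp hr
    obtain ⟨hvl, hnd⟩ := List.nodup_cons.1 hl
    obtain ⟨hp', hm', hrec'⟩ := hF.mate_plusMinus hN hv1 hp hm hv' hmate
    obtain ⟨n, p, q, hear, rfl⟩ := ih hnd (Finset.mem_sdiff.2
      ⟨mem_cherryBlossom.2 (Or.inr ⟨hv', hp', hm', hrec'.trans hrec⟩), hA v hv v' hv' hmate⟩)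
    exact ⟨_, _, _, (hear.cons (b := true) (by simp [hvl]) h1 h2 hadj (by simpa using hM)).mono
      (cons_subset hv), rfl⟩
  | minus v v' l hv1 hm hv' h2 hl' ih =>
    obtain ⟨hp, -, hrec⟩ := plusMinus hv
    obtain ⟨h1, -, hadj, hM⟩ := hF.minusParent v hv1 hm
    obtain ⟨hvl, hnd⟩ := List.nodup_cons.1 hl
    by_cases hv'A : v' ∈ A
    · exact ⟨_, _, _, .single (by simpa using hv) hv'A h1 h2 hadj hM, rfl⟩
    · have hv'C : v' ∈ D.cherryBlossom 𝒩 x := hrec ▸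
        hF.mem_cherryBlossom_receptacle_of_altPath hp hm (.minus v v' l hv1 hm hv' h2 hl') hl'
      obtain ⟨n, p, q, hear, rfl⟩ := ih hnd (Finset.mem_sdiff.2 ⟨hv'C, hv'A⟩)
      exact ⟨_, _, _, (hear.cons (b := false) (by simp [hvl]) h1 h2 hadj (by simpa using hM)).mono
        (cons_subset hv), rfl⟩

/-- The ear of any remaining node ends with an unmatched edge from some `v` to `A`; the ear of `v`
that starts with the matched edge at `v` closes up with it to an odd cycle through `A`. -/
theorem IsCherryForest.exists_oddCycleShrink (hF : D.IsCherryForest H 𝒩) (hN : IsNodeSet 𝒩)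
    (hx : x ∈ 𝒩) (hxA : x ∈ A)
    (hA : ∀ u ∈ D.cherryBlossom 𝒩 x \ A, ∀ v ∈ 𝒩, D.Mates u v → v ∉ A)
    (hne : (D.cherryBlossom 𝒩 x \ A).Nonempty) :
    ∃ Q ⊆ D.cherryBlossom 𝒩 x \ A, Q.Nonempty ∧
      (∀ u ∈ D.cherryBlossom 𝒩 x \ (A ∪ Q), ∀ v ∈ 𝒩, D.Mates u v → v ∉ A ∪ Q) ∧
      OddCycleShrink H D.M x (insert (merge A) (D.cherryBlossom 𝒩 x \ A))
        (insert (merge (A ∪ Q)) (D.cherryBlossom 𝒩 x \ (A ∪ Q))) := by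
  have hsub : D.cherryBlossom 𝒩 x \ A ⊆ 𝒩 :=
    Finset.sdiff_subset.trans (cherryBlossom_subset hx)
  have exists_ear : ∀ u ∈ D.cherryBlossom 𝒩 x \ A, ∃ n p q,
      IsEar H D.M (D.cherryBlossom 𝒩 x \ A) A true n p q ∧ p 0 = u := fun u hu => by
    obtain ⟨huC, huA⟩ := Finset.mem_sdiff.1 hu
    obtain ⟨l, hl, hnd⟩ := hF.plusPath u (hsub hu)
      ((mem_cherryBlossom.1 huC).resolve_left fun h => huA (h ▸ hxA)).2.1
    obtain ⟨n, p, q, hear, h0⟩ := hF.exists_isEar hN hxA hA hl hnd hu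
    exact ⟨n, p, q, hear.mono (Finset.filter_subset _ _), h0⟩
  have hmerge : merge A ∉ D.cherryBlossom 𝒩 x \ A := fun h => by
    obtain ⟨a, ha⟩ := hN.1 x hx
    exact (Finset.mem_sdiff.1 h).2
      (hN.eq_of_mem hx (hsub h) ha (subset_merge hxA ha) ▸ hxA)
  obtain ⟨u, hu⟩ := hne
  obtain ⟨_, _, _, hear, -⟩ := exists_ear u hu
  obtain ⟨v, hv, w, hw, e, he1, he2, hadj, hM⟩ := hear.exists_unmatched_edge
  obtain ⟨n, p, q, hear, rfl⟩ := exists_ear v hv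
  obtain ⟨k, c, f, hcyc, hc0, hc⟩ := hear.exists_isOddCycle (e := e.swap) hmerge
    (subset_merge hear.end_mem) (subset_merge hw he2) he1 hadj.symm (by rwa [Sym2.eq_swap])
  refine ⟨(Finset.range n).image p,
    Finset.image_subset_iff.2 fun i hi => hear.mem i (Finset.mem_range.1 hi),
    ⟨p 0, Finset.mem_image_of_mem p (Finset.mem_range.2 hear.pos)⟩, ?_, k, c, f, hcyc,
    hc0 ▸ subset_merge hxA, by rw [hc, contract_insert_merge hmerge]⟩
  intro u hu w hw hmates hwA
  obtain ⟨huC, huAQ⟩ := Finset.mem_sdiff.1 hu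
  rw [Finset.mem_union, not_or] at huAQ
  rcases Finset.mem_union.1 hwA with hwA | hwQ
  · exact hA u (Finset.mem_sdiff.2 ⟨huC, huAQ.1⟩) w hw hmates hwA
  · obtain ⟨i, hi, rfl⟩ := Finset.mem_image.1 hwQ
    obtain ⟨j, hj, hij⟩ := hear.exists_mates (Finset.mem_range.1 hi)
    refine huAQ.2 (Finset.mem_image.2 ⟨j, Finset.mem_range.2 hj, ?_⟩)
    exact hF.matching.mates_unique hN hw (hsub (hear.mem j hj)) (cherryBlossom_subset hx huC) hij
      hmates.symm

theorem IsCherryForest.shrink_of_mateClosed (hF : D.IsCherryForest H 𝒩) (hN : IsNodeSet 𝒩)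
    (hx : x ∈ 𝒩) (hxA : x ∈ A) (hAC : A ⊆ D.cherryBlossom 𝒩 x)
    (hA : ∀ u ∈ D.cherryBlossom 𝒩 x \ A, ∀ v ∈ 𝒩, D.Mates u v → v ∉ A) :
    Relation.ReflTransGen (OddCycleShrink H D.M x)
      (insert (merge A) (D.cherryBlossom 𝒩 x \ A)) {merge (D.cherryBlossom 𝒩 x)} := by
  induction hn : (D.cherryBlossom 𝒩 x \ A).card using Nat.strong_induction_on generalizing A with
  | _ n ih =>
    obtain hemp | hne := (D.cherryBlossom 𝒩 x \ A).eq_empty_or_nonempty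
    · obtain rfl := hAC.antisymm (Finset.sdiff_eq_empty_iff_subset.1 hemp)
      rw [hemp]
      exact .refl
    · obtain ⟨Q, hQ, ⟨v, hv⟩, hAQ, hstep⟩ := hF.exists_oddCycleShrink hN hx hxA hA hne
      refine .head hstep (ih _ ?_ (Finset.mem_union_left _ hxA)
        (Finset.union_subset hAC (hQ.trans Finset.sdiff_subset)) hAQ rfl)
      subst hn
      exact Finset.card_lt_card (by grind)

theorem IsCherryForest.shrink_cherryBlossom (hF : D.IsCherryForest H 𝒩) (hN : IsNodeSet 𝒩)
    (hx : x ∈ 𝒩) (hm : x ∉ D.minus) :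
    Relation.ReflTransGen (OddCycleShrink H D.M x) (D.cherryBlossom 𝒩 x)
      {merge (D.cherryBlossom 𝒩 x)} := by
  have hshrink := hF.shrink_of_mateClosed hN hx (Finset.mem_singleton_self x)
    (Finset.singleton_subset_iff.2 self_mem_cherryBlossom) fun u hu v hv hM hvx => by
      obtain rfl := Finset.mem_singleton.1 hvx
      obtain ⟨huC, huv⟩ := Finset.mem_sdiff.1 hu
      obtain ⟨hu𝒩, hup, hum, -⟩ :=
        (mem_cherryBlossom.1 huC).resolve_left fun h => huv (Finset.mem_singleton.2 h)
      exact hm (hF.mate_plusMinus hN hu𝒩 hup hum hv hM).2.1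
  rwa [merge_singleton, ← Finset.erase_eq, Finset.insert_erase self_mem_cherryBlossom] at hshrink

theorem IsCherryForest.shrink_to_contract (hF : D.IsCherryForest H 𝒩) (hN : IsNodeSet 𝒩)
    (hx : x ∈ 𝒩) (hm : x ∉ D.minus) :
    Relation.ReflTransGen (OddCycleShrink H D.M x) 𝒩 (contract 𝒩 (D.cherryBlossom 𝒩 x)) := by
  have hC : D.cherryBlossom 𝒩 x ⊆ 𝒩 := cherryBlossom_subset hx
  have hunion := reflTransGen_oddCycleShrink_union (𝒪 := 𝒩 \ D.cherryBlossom 𝒩 x)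
    (hF.shrink_cherryBlossom hN hx hm) fun o ho u hu => by
      obtain ⟨ho𝒩, hoC⟩ := Finset.mem_sdiff.1 ho
      exact ⟨hN.1 u (hC hu), hN.2 o ho𝒩 u (hC hu) fun h => hoC (h ▸ hu)⟩
  rwa [Finset.sdiff_union_of_subset hC, Finset.union_comm, ← Finset.insert_eq] at hunion

end CherryData

/-! ### Refining a laminar family by traditional blossoms -/

section OddCycle

variable {V : Type*} {H : SimpleGraph V} {M : Finset (Sym2 V)} {D : AltData V}
  {𝒩 : Finset (Finset V)} {k : ℕ} {c : Fin (2 * k + 1) → Finset V}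
  {e : Fin (2 * k + 1) → V × V}

theorem IsOddCycle.exists_mates (h : IsOddCycle H D.M 𝒩 k c e) {i : Fin (2 * k + 1)}
    (hi : i ≠ 0) : ∃ j, D.Mates (c i) (c j) := by
  have hk := h.pos
  have succ_ne : ∀ i : Fin (2 * k + 1), i ≠ i + 1 := fun i => by
    rw [ne_eq, left_eq_add, Fin.one_eq_zero_iff]
    omega
  have mates_succ : ∀ i : Fin (2 * k + 1), Odd (i : ℕ) → D.Mates (c i) (c (i + 1)) := fun i ho =>
    ⟨fun hc => succ_ne i (h.inj hc), _, (h.edge i).1, _, (h.edge i).2.1, (h.alternating i).2 ho⟩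
  rcases Nat.even_or_odd (i : ℕ) with he | ho
  · have hodd : Odd ((i - 1 : Fin (2 * k + 1)) : ℕ) := by
      have := Fin.val_ne_zero_iff.2 hi
      rw [Fin.val_sub_one_of_ne_zero hi]
      grind
    exact ⟨i - 1, by simpa using (mates_succ (i - 1) hodd).symm⟩
  · exact ⟨i + 1, mates_succ i ho⟩

variable [DecidableEq V]

theorem IsOddCycle.image_subset (h : IsOddCycle H M 𝒩 k c e) : Finset.univ.image c ⊆ 𝒩 :=
  Finset.image_subset_iff.2 fun i _ => h.mem i

theorem IsOddCycle.one_lt_card (h : IsOddCycle H M 𝒩 k c e) : 1 < (Finset.univ.image c).card := by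
  rw [Finset.card_image_of_injective _ h.inj, Finset.card_univ, Fintype.card_fin]
  have := h.pos
  omega

theorem IsOddCycle.image_nonempty (h : IsOddCycle H M 𝒩 k c e) :
    (Finset.univ.image c).Nonempty :=
  Finset.card_pos.1 (zero_lt_one.trans h.one_lt_card)

theorem IsOddCycle.restrict (h : IsOddCycle H M 𝒩 k c e) :
    IsOddCycle H M (Finset.univ.image c) k c e :=
  { h with mem := fun i => Finset.mem_image_of_mem c (Finset.mem_univ i) }

end OddCycle

namespace AltData

variable {V : Type*} {D : AltData V} {H : SimpleGraph V} {𝒩 𝒩' : Finset (Finset V)}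

theorem IsMatching.of_representatives (hM : D.IsMatching H 𝒩) (rep : Finset V → Finset V)
    (hrep : ∀ u ∈ 𝒩', rep u ∈ 𝒩) (hinj : Set.InjOn rep 𝒩')
    (hmem : ∀ u ∈ 𝒩', ∀ v ∈ 𝒩', u ≠ v → ∀ a ∈ u, ∀ b ∈ v, s(a, b) ∈ D.M → a ∈ rep u) :
    D.IsMatching H 𝒩' := by
  have hmem' : ∀ u ∈ 𝒩', ∀ v ∈ 𝒩', u ≠ v → ∀ a ∈ u, ∀ b ∈ v, s(a, b) ∈ D.M → b ∈ rep v :=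
    fun u hu v hv huv a ha b hb hab =>
      hmem v hv u hu huv.symm b hb a ha (by rwa [Sym2.eq_swap])
  refine ⟨fun u hu v hv huv a ha b hb hab => ?_,
    fun u hu v hv v' hv' huv huv' a ha b hb a' ha' b' hb' hab hab' => ?_⟩
  · exact hM.1 _ (hrep u hu) _ (hrep v hv) (hinj.ne hu hv huv) a
      (hmem u hu v hv huv a ha b hb hab) b (hmem' u hu v hv huv a ha b hb hab) hab
  · exact hM.2 _ (hrep u hu) _ (hrep v hv) _ (hrep v' hv') (hinj.ne hu hv huv)
      (hinj.ne hu hv' huv') a (hmem u hu v hv huv a ha b hb hab) b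
      (hmem' u hu v hv huv a ha b hb hab) a' (hmem u hu v' hv' huv' a' ha' b' hb' hab') b'
      (hmem' u hu v' hv' huv' a' ha' b' hb' hab') hab hab'

theorem IsMatching.subset (hM : D.IsMatching H 𝒩) (hs : 𝒩' ⊆ 𝒩) : D.IsMatching H 𝒩' :=
  hM.of_representatives id (fun _ hu => hs hu) (Set.injOn_id _) fun _ _ _ _ _ _ ha _ _ _ => ha

end AltData

section Contract

open AltData

variable {V : Type*} [DecidableEq V] {D : AltData V} {H : SimpleGraph V}
  {𝒩 : Finset (Finset V)} {k : ℕ} {c : Fin (2 * k + 1) → Finset V} {e : Fin (2 * k + 1) → V × V}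

theorem IsOddCycle.mem_base_of_mem_matching (h : IsOddCycle H D.M 𝒩 k c e) (hN : IsNodeSet 𝒩)
    (hM : D.IsMatching H 𝒩) {v : Finset V} (hv : v ∈ 𝒩) (hvc : v ∉ Finset.univ.image c) {a b : V}
    (ha : a ∈ merge (Finset.univ.image c)) (hb : b ∈ v) (hab : s(a, b) ∈ D.M) : a ∈ c 0 := by
  obtain ⟨u, hu, hau⟩ := mem_merge.1 ha
  obtain ⟨i, -, rfl⟩ := Finset.mem_image.1 hu
  by_cases hi : i = 0
  · exact hi ▸ hau
  obtain ⟨j, hj⟩ := h.exists_mates hi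
  have hmates : D.Mates (c i) v := ⟨fun hiv => hvc (hiv ▸ hu), a, hau, b, hb, hab⟩
  rw [← hM.mates_unique hN (h.mem i) (h.mem j) hv hj hmates] at hvc
  exact (hvc (Finset.mem_image_of_mem c (Finset.mem_univ j))).elim

/-- Matched edges that leave the cycle do so at its base, which can therefore represent the
contracted node. -/
theorem IsOddCycle.isMatching_contract (h : IsOddCycle H D.M 𝒩 k c e) (hN : IsNodeSet 𝒩)
    (hM : D.IsMatching H 𝒩) : D.IsMatching H (contract 𝒩 (Finset.univ.image c)) := by
  set C := Finset.univ.image c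
  have hc0 : c 0 ∈ C := Finset.mem_image_of_mem c (Finset.mem_univ 0)
  have mem_sdiff : ∀ {u}, u ∈ contract 𝒩 C → u ≠ merge C → u ∈ 𝒩 ∧ u ∉ C := fun hu hne =>
    Finset.mem_sdiff.1 ((Finset.mem_insert.1 hu).resolve_left hne)
  refine hM.of_representatives (fun u => if u = merge C then c 0 else u) (fun u hu => ?_)
    (fun u hu v hv huv => ?_) fun u _ v hv huv a ha b hb hab => ?_
  · split_ifs with huC
    exacts [h.mem 0, (mem_sdiff hu huC).1]
  · dsimp only at huv
    split_ifs at huv with huC hvC hvC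
    · rw [huC, hvC]
    · exact ((mem_sdiff hv hvC).2 (huv ▸ hc0)).elim
    · exact ((mem_sdiff hu huC).2 (huv ▸ hc0)).elim
    · exact huv
  · split_ifs with huC
    · obtain ⟨hv𝒩, hvC⟩ := mem_sdiff hv fun hvC => huv (huC.trans hvC.symm)
      exact h.mem_base_of_mem_matching hN hM hv𝒩 hvC (huC ▸ ha) hb hab
    · exact ha

end Contract

section TradBlossom

open AltData

variable {V : Type*} [Fintype V] [DecidableEq V] {D : AltData V} {H : SimpleGraph V}
  {𝓑 𝓑' C : Finset (Finset V)} {A B : Finset V} {P : Finset V → Prop}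

/-- A traditional blossom: the elements of `B` are the nodes of an odd alternating cycle, and the
matched edges between them form a matching. -/
def IsTradBlossom (D : AltData V) (H : SimpleGraph V) (𝓑 : Finset (Finset V)) (B : Finset V) :
    Prop :=
  D.IsMatching H (children 𝓑 B) ∧
    ∃ (k : ℕ) (c : Fin (2 * k + 1) → Finset V) (e : Fin (2 * k + 1) → V × V),
      IsOddCycle H D.M (children 𝓑 B) k c e ∧ Finset.univ.image c = children 𝓑 B

theorem IsTradBlossom.congr (h : IsTradBlossom D H 𝓑 B) (hc : children 𝓑' B = children 𝓑 B) :
    IsTradBlossom D H 𝓑' B := by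
  unfold IsTradBlossom
  rwa [hc]

theorem merge_subset_of_subset_children (hC : C ⊆ children 𝓑 B) : merge C ⊆ B :=
  Finset.biUnion_subset.2 fun _ hu =>
    (mem_maxNodes.1 (children_eq_maxNodes (𝓑 := 𝓑) B ▸ hC hu)).2.1.subset

theorem IsLaminar.eq_children_of_merge_eq (h : IsLaminar 𝓑) (hB : 1 < B.card)
    (hC : C ⊆ children 𝓑 B) (hCB : merge C = B) : C = children 𝓑 B := by
  refine hC.antisymm fun u hu => ?_
  obtain ⟨a, ha⟩ := (h.isNodeSet_children B).1 u hu
  obtain ⟨v, hv, hav⟩ := mem_merge.1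
    (show a ∈ merge C by rw [hCB, ← merge_children (𝓑 := 𝓑) hB]; exact subset_merge hu ha)
  rwa [(h.isNodeSet_children B).eq_of_mem hu (hC hv) ha hav]

theorem IsLaminar.isTradBlossom_insert_merge (h : IsLaminar 𝓑) (hP : IsLevel 𝓑 P)
    (hM : D.IsMatching H (maxNodes 𝓑 P)) {k : ℕ} {c : Fin (2 * k + 1) → Finset V}
    {e : Fin (2 * k + 1) → V × V} (hc : IsOddCycle H D.M (maxNodes 𝓑 P) k c e)
    (hPc : P (merge (Finset.univ.image c))) :
    IsTradBlossom D H (insert (merge (Finset.univ.image c)) 𝓑) (merge (Finset.univ.image c)) := by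
  unfold IsTradBlossom
  rw [h.children_insert_merge hP hc.image_subset hPc hc.one_lt_card]
  exact ⟨hM.subset hc.image_subset, k, c, e, hc.restrict, rfl⟩

theorem children_insert_merge_of_topNodes (hC : C ⊆ topNodes 𝓑) (hne : C.Nonempty) (hA : A ∈ 𝓑) :
    children (insert (merge C) 𝓑) A = children 𝓑 A := by
  rw [topNodes_eq_maxNodes] at hC
  rw [children_eq_maxNodes, children_eq_maxNodes]
  exact maxNodes_insert_of_not_maximal fun hlt =>
    (not_of_merge_ssubset hC hne (mem_nodes_of_mem hA) hlt trivial).elim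

theorem IsLaminar.children_insert_merge_of_children (h : IsLaminar 𝓑) (hB : B ∈ 𝓑)
    (hC : C ⊆ children 𝓑 B) (hne : C.Nonempty) (hCB : merge C ⊂ B) (hA : A ∈ 𝓑) (hAB : A ≠ B) :
    children (insert (merge C) 𝓑) A = children 𝓑 A := by
  obtain ⟨u, hu⟩ := hne
  obtain ⟨a, ha⟩ := (h.isNodeSet_children B).1 u (hC hu)
  rw [children_eq_maxNodes] at hC
  rw [children_eq_maxNodes, children_eq_maxNodes]
  refine maxNodes_insert_of_not_maximal fun hlt => ⟨B, mem_nodes_of_mem hB, hCB, ?_⟩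
  rcases h.2 A hA B hB with hsub | hsub | hd
  · exact (not_of_merge_ssubset hC ⟨u, hu⟩ (mem_nodes_of_mem hA) hlt
      (hsub.ssubset_of_ne hAB)).elim
  · exact hsub.ssubset_of_ne hAB.symm
  · have haC : a ∈ merge C := subset_merge hu ha
    exact (Finset.disjoint_left.1 hd (hlt.1 haC) (hCB.1 haC)).elim

theorem topNodes_insert_of_ssubset (hB : B ∈ 𝓑) (hAB : A ⊂ B) :
    topNodes (insert A 𝓑) = topNodes 𝓑 := by
  rw [topNodes_eq_maxNodes, topNodes_eq_maxNodes]
  exact maxNodes_insert_of_not_maximal fun _ => ⟨B, mem_nodes_of_mem hB, hAB, trivial⟩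

theorem IsLaminar.exists_refinement_top {𝒩 𝒩' : Finset (Finset V)}
    (hchain : Relation.ReflTransGen (OddCycleShrink H D.M ∅) 𝒩 𝒩') (h : IsLaminar 𝓑)
    (htop : topNodes 𝓑 = 𝒩) (hM : D.IsMatching H 𝒩) (hB : ∀ B ∈ 𝓑, IsTradBlossom D H 𝓑 B) :
    ∃ 𝓑', 𝓑 ⊆ 𝓑' ∧ IsLaminar 𝓑' ∧ topNodes 𝓑' = 𝒩' ∧ D.IsMatching H 𝒩' ∧
      ∀ B ∈ 𝓑', IsTradBlossom D H 𝓑' B := by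
  induction hchain using Relation.ReflTransGen.head_induction_on generalizing 𝓑 with
  | refl => exact ⟨𝓑, subset_rfl, h, htop, hM, hB⟩
  | head hstep _ ih =>
    obtain ⟨k, c, e, hc, -, rfl⟩ := hstep
    subst htop
    have hM' := hc.isMatching_contract h.isNodeSet_topNodes hM
    have htop := hc.image_subset
    rw [topNodes_eq_maxNodes] at hc hM ih hM'
    have hsub := hc.image_subset
    obtain ⟨𝓑', h1, h2, h3⟩ := ih (h.insert_merge isLevel_true hsub trivial hc.one_lt_card)
      (by rw [topNodes_eq_maxNodes, h.maxNodes_insert_merge hsub trivial hc.one_lt_card]) hM'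
      (fun B hB' => by
        rcases Finset.mem_insert.1 hB' with rfl | hB'
        · exact h.isTradBlossom_insert_merge isLevel_true hM hc trivial
        · exact (hB B hB').congr (children_insert_merge_of_topNodes htop hc.image_nonempty hB'))
    exact ⟨𝓑', (Finset.subset_insert _ _).trans h1, h2, h3⟩

theorem IsLaminar.exists_refinement_supernode {𝒩 : Finset (Finset V)}
    (hchain : Relation.ReflTransGen (OddCycleShrink H D.M ∅) 𝒩 {B}) (h : IsLaminar 𝓑)
    (hB : B ∈ 𝓑) (hch : children 𝓑 B = 𝒩) (hM : D.IsMatching H 𝒩) :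
    ∃ 𝓑', 𝓑 ⊆ 𝓑' ∧ IsLaminar 𝓑' ∧ topNodes 𝓑' = topNodes 𝓑 ∧
      (∀ A ∈ 𝓑, A ≠ B → children 𝓑' A = children 𝓑 A) ∧
      ∀ A ∈ 𝓑', A ∉ 𝓑 ∨ A = B → IsTradBlossom D H 𝓑' A := by
  induction hchain using Relation.ReflTransGen.head_induction_on generalizing 𝓑 with
  | refl =>
    have hBB : B ∈ maxNodes 𝓑 (· ⊂ B) := by
      rw [← children_eq_maxNodes, hch]
      exact Finset.mem_singleton_self B
    exact ((mem_maxNodes.1 hBB).2.1.ne rfl).elim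
  | head hstep _ ih =>
    obtain ⟨k, c, e, hc, -, rfl⟩ := hstep
    subst hch
    have hCch := hc.image_subset
    obtain hCB | hCB := (merge_subset_of_subset_children hCch).eq_or_ssubset
    · refine ⟨𝓑, subset_rfl, h, rfl, fun _ _ _ => rfl, fun A hA hA' => ?_⟩
      obtain rfl : A = B := hA'.resolve_left fun hA' => hA' hA
      exact ⟨hM, k, c, e, hc, h.eq_children_of_merge_eq (h.1 A hB) hCch hCB⟩
    · have hM' := hc.isMatching_contract (h.isNodeSet_children B) hM
      have hlev := h.isLevel_ssubset (mem_nodes_of_mem hB)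
      rw [children_eq_maxNodes] at hc hM ih hM'
      have hsub := hc.image_subset
      have hnew := h.isTradBlossom_insert_merge hlev hM hc hCB
      obtain ⟨𝓑', h1, h2, h3, h4, h5⟩ := ih (h.insert_merge hlev hsub hCB hc.one_lt_card)
        (Finset.mem_insert_of_mem hB)
        (by rw [children_eq_maxNodes, h.maxNodes_insert_merge hsub hCB hc.one_lt_card]) hM'
      refine ⟨𝓑', (Finset.subset_insert _ _).trans h1, h2,
        h3.trans (topNodes_insert_of_ssubset hB hCB), fun A hA hAB => ?_, fun A hA hA' => ?_⟩
      · rw [h4 A (Finset.mem_insert_of_mem hA) hAB,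
          h.children_insert_merge_of_children hB hCch hc.image_nonempty hCB hA hAB]
      · by_cases hAc : A = merge (Finset.univ.image c)
        · subst hAc
          exact hnew.congr (h4 _ (Finset.mem_insert_self _ _) hCB.ne)
        · exact h5 A hA (hA'.imp_left fun hA𝓑 hins => (Finset.mem_insert.1 hins).elim hAc hA𝓑)

/-- The supernodes are treated one at a time; those in `𝓢` are traditional blossoms already. -/
theorem IsLaminar.exists_refinement (h : IsLaminar 𝓑)
    (hB : ∀ B ∈ 𝓑, D.IsMatching H (children 𝓑 B) ∧
      Relation.ReflTransGen (OddCycleShrink H D.M ∅) (children 𝓑 B) {B}) :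
    ∃ 𝓑', 𝓑 ⊆ 𝓑' ∧ IsLaminar 𝓑' ∧ topNodes 𝓑' = topNodes 𝓑 ∧
      ∀ A ∈ 𝓑', IsTradBlossom D H 𝓑' A := by
  suffices H' : ∀ 𝓢 ⊆ 𝓑, ∃ 𝓑', 𝓑 ⊆ 𝓑' ∧ IsLaminar 𝓑' ∧ topNodes 𝓑' = topNodes 𝓑 ∧
      (∀ A ∈ 𝓑 \ 𝓢, children 𝓑' A = children 𝓑 A) ∧
      ∀ A ∈ 𝓑', A ∉ 𝓑 \ 𝓢 → IsTradBlossom D H 𝓑' A by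
    obtain ⟨𝓑', h1, h2, h3, -, h5⟩ := H' 𝓑 subset_rfl
    exact ⟨𝓑', h1, h2, h3, fun A hA => h5 A hA (by simp)⟩
  intro 𝓢
  induction 𝓢 using Finset.induction_on with
  | empty =>
    intro _
    exact ⟨𝓑, subset_rfl, h, rfl, fun _ _ => rfl, fun A hA hA' => (hA' (by simpa using hA)).elim⟩
  | insert B 𝓢 hBS ih =>
    intro hsub
    obtain ⟨𝓑', h1, h2, h3, h4, h5⟩ := ih ((Finset.subset_insert _ _).trans hsub)
    have hBm : B ∈ 𝓑 := hsub (Finset.mem_insert_self _ _)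
    have hBch := h4 B (Finset.mem_sdiff.2 ⟨hBm, hBS⟩)
    obtain ⟨𝓑'', g1, g2, g3, g4, g5⟩ :=
      h2.exists_refinement_supernode (hB B hBm).2 (h1 hBm) hBch (hB B hBm).1
    refine ⟨𝓑'', h1.trans g1, g2, g3.trans h3, fun A hA => ?_, fun A hA hA' => ?_⟩
    · simp only [Finset.mem_sdiff, Finset.mem_insert, not_or] at hA
      rw [g4 A (h1 hA.1) hA.2.1, h4 A (Finset.mem_sdiff.2 ⟨hA.1, hA.2.2⟩)]
    · by_cases hAB : A = B
      · exact g5 A hA (Or.inr hAB)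
      by_cases hAm : A ∈ 𝓑'
      · exact (h5 A hAm fun hA𝓢 => hA' (by grind)).congr (g4 A hAm hAB)
      · exact g5 A hA (Or.inl hAm)

end TradBlossom

/-! ### The traditional state that realizes a state of Blossom VI -/

namespace CherryState

open AltData CherryData

variable {V : Type*} [Fintype V] [DecidableEq V] {s : CherryState V} {H : SimpleGraph V}

theorem mem_pureTop {x : Finset V} :
    x ∈ s.pureTop ↔ x ∈ s.top ∧ ¬ (x ∈ s.plus ∧ x ∈ s.minus) := by
  simp [pureTop]

theorem base_eq_self {x : Finset V} (hx : x ∈ s.pureTop) : s.base x = x :=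
  if_neg (mem_pureTop.1 hx).2

theorem mem_pureTop_of_isRoot (hF : s.IsCherryForest H s.top) {r : Finset V}
    (hr : s.IsRoot s.top r) : r ∈ s.pureTop :=
  mem_pureTop.2 ⟨hr.1, fun h => (hF.root r hr).2 h.2⟩

theorem base_mem_pureTop (hF : s.IsCherryForest H s.top) {u : Finset V} (hu : u ∈ s.top) :
    s.base u ∈ s.pureTop := by
  unfold CherryData.base
  split_ifs with h
  · obtain ⟨hmem, -, hminus⟩ := hF.receptacle_plus u hu h.1 h.2
    exact mem_pureTop.2 ⟨hmem, fun hpm => hminus hpm.2⟩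
  · exact mem_pureTop.2 ⟨hu, h⟩

theorem mem_cherryBlossom_iff {x u : Finset V} (hx : x ∈ s.pureTop) (hu : u ∈ s.top) :
    u ∈ s.cherryBlossom s.top x ↔ s.base u = x := by
  rw [CherryData.mem_cherryBlossom]
  unfold CherryData.base
  split_ifs with h
  · constructor
    · rintro (rfl | h1)
      · exact ((mem_pureTop.1 hx).2 h).elim
      · exact h1.2.2.2
    · exact fun h1 => Or.inr ⟨hu, h.1, h.2, h1⟩
  · constructor
    · rintro (h1 | h1)
      · exact h1
      · exact (h ⟨h1.2.1, h1.2.2.1⟩).elim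
    · exact Or.inl

theorem cherryBlossom_subset_top {x : Finset V} (hx : x ∈ s.pureTop) :
    s.cherryBlossom s.top x ⊆ s.top :=
  cherryBlossom_subset (mem_pureTop.1 hx).1

theorem base_eq_of_altPath (hF : s.IsCherryForest H s.top) {v v' : Finset V} {b b' : Bool}
    {l : List (Finset V)} (hp : v ∈ s.plus) (hm : v ∈ s.minus)
    (h : s.AltPath s.top v b (v :: l)) (hl : s.AltPath s.top v' b' l) : s.base v = s.base v' := by
  refine ((mem_cherryBlossom_iff (base_mem_pureTop hF h.mem) hl.mem).1 ?_).symm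
  rw [CherryData.base, if_pos ⟨hp, hm⟩]
  exact hF.mem_cherryBlossom_receptacle_of_altPath hp hm h hl

theorem base_eq_of_mates (hF : s.IsCherryForest H s.top) (hN : IsNodeSet s.top) {v v' : Finset V}
    (hp : v ∈ s.plus) (hm : v ∈ s.minus) (hv : v ∈ s.top) (hv' : v' ∈ s.top) (h : s.Mates v v') :
    s.base v = s.base v' := by
  obtain ⟨l, hvl, hl⟩ := hF.exists_altPath_cons_of_mates hN hv hp hv' h
  exact base_eq_of_altPath hF hp hm hvl hl

theorem mem_shrunk_iff (hN : IsNodeSet s.top) {x u : Finset V} {a : V} (hx : x ∈ s.pureTop)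
    (hu : u ∈ s.top) (ha : a ∈ u) : a ∈ s.shrunk x ↔ s.base u = x := by
  rw [← mem_cherryBlossom_iff hx hu, shrunk, mem_merge]
  constructor
  · rintro ⟨v, hv, hav⟩
    rwa [hN.eq_of_mem hu (cherryBlossom_subset_top hx hv) ha hav]
  · exact fun h => ⟨u, h, ha⟩

theorem exists_mem_of_mem_shrunk {x : Finset V} {a : V} (hx : x ∈ s.pureTop)
    (ha : a ∈ s.shrunk x) : ∃ u ∈ s.top, a ∈ u ∧ s.base u = x := by
  obtain ⟨u, hu, hau⟩ := mem_merge.1 ha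
  have hu' := cherryBlossom_subset_top hx hu
  exact ⟨u, hu', hau, (mem_cherryBlossom_iff hx hu').1 hu⟩

theorem subset_shrunk (x : Finset V) : x ⊆ s.shrunk x :=
  subset_merge self_mem_cherryBlossom

theorem disjoint_shrunk (hN : IsNodeSet s.top) {x x' : Finset V} (hx : x ∈ s.pureTop)
    (hx' : x' ∈ s.pureTop) (h : x ≠ x') : Disjoint (s.shrunk x) (s.shrunk x') := by
  rw [Finset.disjoint_left]
  intro a ha ha'
  obtain ⟨u, hu, hau, rfl⟩ := exists_mem_of_mem_shrunk hx ha
  exact h ((mem_shrunk_iff hN hx' hu hau).1 ha')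

theorem shrunk_injOn (hN : IsNodeSet s.top) {x x' : Finset V} (hx : x ∈ s.pureTop)
    (hx' : x' ∈ s.pureTop) (h : s.shrunk x = s.shrunk x') : x = x' := by
  have hxt := (mem_pureTop.1 hx).1
  obtain ⟨a, ha⟩ := hN.1 x hxt
  rw [← (mem_shrunk_iff hN hx' hxt ha).1 (h ▸ subset_shrunk x ha), base_eq_self hx]

theorem mates_shrunk_iff (hF : s.IsCherryForest H s.top) (hN : IsNodeSet s.top) {x x' : Finset V}
    (hx : x ∈ s.pureTop) (hx' : x' ∈ s.pureTop) :
    s.Mates (s.shrunk x) (s.shrunk x') ↔ s.Mates x x' := by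
  constructor
  · rintro ⟨hne, a, ha, b, hb, hM⟩
    obtain ⟨u, hu, hau, rfl⟩ := exists_mem_of_mem_shrunk hx ha
    obtain ⟨v, hv, hbv, rfl⟩ := exists_mem_of_mem_shrunk hx' hb
    have hne' : s.base u ≠ s.base v := fun h => hne (by rw [h])
    have hm : s.Mates u v := ⟨fun h => hne' (by rw [h]), a, hau, b, hbv, hM⟩
    by_cases hpm : u ∈ s.plus ∧ u ∈ s.minus
    · exact (hne' (base_eq_of_mates hF hN hpm.1 hpm.2 hu hv hm)).elim
    · have hpm' := hF.not_plusMinus_of_mates hN hu hpm hv hm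
      rwa [base_eq_self (mem_pureTop.2 ⟨hu, hpm⟩), base_eq_self (mem_pureTop.2 ⟨hv, hpm'⟩)]
  · rintro ⟨hne, a, ha, b, hb, hM⟩
    exact ⟨fun h => hne (shrunk_injOn hN hx hx' h), a, subset_shrunk x ha, b, subset_shrunk x' hb,
      hM⟩

theorem mate_mem_pureTop (hF : s.IsCherryForest H s.top) (hN : IsNodeSet s.top) {x z : Finset V}
    (hx : x ∈ s.pureTop) (hz : z ∈ s.top) (h : s.Mates x z) : z ∈ s.pureTop :=
  mem_pureTop.2 ⟨hz, hF.not_plusMinus_of_mates hN (mem_pureTop.1 hx).1 (mem_pureTop.1 hx).2 hz h⟩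

theorem isRoot_shrunk_iff (hF : s.IsCherryForest H s.top) (hN : IsNodeSet s.top) {x : Finset V}
    (hx : x ∈ s.pureTop) :
    s.IsRoot (s.pureTop.image s.shrunk) (s.shrunk x) ↔ s.IsRoot s.top x := by
  constructor
  · rintro ⟨-, h⟩
    refine ⟨(mem_pureTop.1 hx).1, fun v hv hM => ?_⟩
    have hv' := mate_mem_pureTop hF hN hx hv hM
    exact h _ (Finset.mem_image_of_mem _ hv') ((mates_shrunk_iff hF hN hx hv').2 hM)
  · rintro ⟨-, h⟩
    refine ⟨Finset.mem_image_of_mem _ hx, fun v hv hM => ?_⟩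
    obtain ⟨x', hx', rfl⟩ := Finset.mem_image.1 hv
    exact h x' (mem_pureTop.1 hx').1 ((mates_shrunk_iff hF hN hx hx').1 hM)

theorem cherryBlossom_eq_singleton (hF : s.IsCherryForest H s.top) {x : Finset V}
    (hm : x ∈ s.minus) : s.cherryBlossom s.top x = {x} := by
  ext v
  rw [CherryData.mem_cherryBlossom, Finset.mem_singleton]
  refine ⟨fun h => h.elim id fun h => ?_, Or.inl⟩
  exact ((hF.receptacle_plus v h.1 h.2.1 h.2.2.1).2.2 (h.2.2.2 ▸ hm)).elim

theorem shrink_cherryBlossom (hF : s.IsCherryForest H s.top) (hN : IsNodeSet s.top)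
    {x : Finset V} (hx : x ∈ s.pureTop) :
    Relation.ReflTransGen (OddCycleShrink H s.M ∅) (s.cherryBlossom s.top x) {s.shrunk x} := by
  by_cases hm : x ∈ s.minus
  · rw [shrunk, cherryBlossom_eq_singleton hF hm, merge_singleton]
  · exact Relation.ReflTransGen.mono (fun _ _ h => h.of_subset (Finset.empty_subset _)) _ _
      (hF.shrink_cherryBlossom hN (mem_pureTop.1 hx).1 hm)

theorem biUnion_cherryBlossom (hF : s.IsCherryForest H s.top) :
    s.pureTop.biUnion (s.cherryBlossom s.top) = s.top := by
  refine Finset.Subset.antisymm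
    (Finset.biUnion_subset.2 fun x hx => cherryBlossom_subset_top hx) fun u hu => ?_
  have hb := base_mem_pureTop hF hu
  exact Finset.mem_biUnion.2 ⟨s.base u, hb, (mem_cherryBlossom_iff hb hu).2 rfl⟩

/-- The node set in which exactly the cherry blossoms of the receptacles in `𝓢` are shrunk; it
interpolates between the current graph and its shrunk version. -/
def partlyShrunk (s : CherryState V) (𝓢 : Finset (Finset V)) : Finset (Finset V) :=
  (s.pureTop \ 𝓢).biUnion (s.cherryBlossom s.top) ∪ 𝓢.image s.shrunk

theorem exists_subset_shrunk_of_mem {𝓢 𝓣 : Finset (Finset V)} {o : Finset V}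
    (ho : o ∈ 𝓣.biUnion (s.cherryBlossom s.top) ∪ 𝓢.image s.shrunk) :
    ∃ x ∈ 𝓣 ∪ 𝓢, o ⊆ s.shrunk x := by
  rcases Finset.mem_union.1 ho with ho | ho
  · obtain ⟨x, hx, hox⟩ := Finset.mem_biUnion.1 ho
    exact ⟨x, Finset.mem_union_left _ hx, subset_merge hox⟩
  · obtain ⟨x, hx, rfl⟩ := Finset.mem_image.1 ho
    exact ⟨x, Finset.mem_union_right _ hx, subset_rfl⟩

theorem shrink_partlyShrunk_insert (hF : s.IsCherryForest H s.top) (hN : IsNodeSet s.top)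
    {𝓢 : Finset (Finset V)} (h𝓢 : 𝓢 ⊆ s.pureTop) {x : Finset V} (hx : x ∈ s.pureTop)
    (hx𝓢 : x ∉ 𝓢) :
    Relation.ReflTransGen (OddCycleShrink H s.M ∅) (s.partlyShrunk 𝓢)
      (s.partlyShrunk (insert x 𝓢)) := by
  have hlift := reflTransGen_oddCycleShrink_union
    (𝒪 := (s.pureTop \ insert x 𝓢).biUnion (s.cherryBlossom s.top) ∪ 𝓢.image s.shrunk)
    (shrink_cherryBlossom hF hN hx) ?_
  · convert hlift using 1
    · have hsplit : s.pureTop \ 𝓢 = insert x (s.pureTop \ insert x 𝓢) := by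
        rw [Finset.sdiff_insert, Finset.insert_erase (Finset.mem_sdiff.2 ⟨hx, hx𝓢⟩)]
      rw [partlyShrunk, hsplit, Finset.biUnion_insert, Finset.union_assoc, Finset.union_comm]
    · rw [partlyShrunk, Finset.image_insert, Finset.union_insert,
        Finset.union_comm _ {s.shrunk x}, ← Finset.insert_eq]
  · intro o ho u hu
    obtain ⟨x', hx', hox'⟩ := exists_subset_shrunk_of_mem ho
    have hx'x : x' ∈ s.pureTop ∧ x' ≠ x := by
      rcases Finset.mem_union.1 hx' with h | h
      · rw [Finset.mem_sdiff, Finset.mem_insert, not_or] at h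
        exact ⟨h.1, h.2.1⟩
      · exact ⟨h𝓢 h, fun hxx => hx𝓢 (hxx ▸ h)⟩
    exact ⟨hN.1 u (cherryBlossom_subset_top hx hu),
      (disjoint_shrunk hN hx'x.1 hx hx'x.2).mono hox' (subset_merge hu)⟩

theorem shrink_top (hF : s.IsCherryForest H s.top) (hN : IsNodeSet s.top) :
    Relation.ReflTransGen (OddCycleShrink H s.M ∅) s.top (s.pureTop.image s.shrunk) := by
  suffices hpartly : ∀ 𝓢 ⊆ s.pureTop,
      Relation.ReflTransGen (OddCycleShrink H s.M ∅) s.top (s.partlyShrunk 𝓢) by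
    simpa [partlyShrunk] using hpartly s.pureTop subset_rfl
  intro 𝓢
  induction 𝓢 using Finset.induction_on with
  | empty =>
    intro _
    rw [partlyShrunk, Finset.sdiff_empty, biUnion_cherryBlossom hF, Finset.image_empty,
      Finset.union_empty]
  | insert x 𝓢 hx𝓢 ih =>
    intro hsub
    obtain ⟨hx, h𝓢⟩ := Finset.insert_subset_iff.1 hsub
    exact (ih h𝓢).trans (shrink_partlyShrunk_insert hF hN h𝓢 hx hx𝓢)

open Classical in
/-- A node that becomes `S` when all cherry blossoms are shrunk, if there is one. -/
noncomputable def unshrunk (s : CherryState V) (S : Finset V) : Finset V :=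
  if h : ∃ x ∈ s.pureTop, s.shrunk x = S then h.choose else S

theorem unshrunk_shrunk (hN : IsNodeSet s.top) {x : Finset V} (hx : x ∈ s.pureTop) :
    s.unshrunk (s.shrunk x) = x := by
  have h : ∃ z ∈ s.pureTop, s.shrunk z = s.shrunk x := ⟨x, hx, rfl⟩
  rw [unshrunk, dif_pos h]
  exact shrunk_injOn hN h.choose_spec.1 hx h.choose_spec.2

/-- The traditional state with blossoms `𝓑` in which all cherry blossoms are shrunk. -/
noncomputable def toTrad (s : CherryState V) (𝓑 : Finset (Finset V)) : TradState V where
  M := s.M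
  plus := (s.pureTop.filter fun x => x ∈ s.plus).image s.shrunk
  minus := (s.pureTop.filter fun x => x ∈ s.minus).image s.shrunk
  plusParent S := s.plusParent (s.unshrunk S)
  minusParent S := s.minusParent (s.unshrunk S)
  blossoms := 𝓑
  y := s.y

variable {𝓑 : Finset (Finset V)}

theorem shrunk_mem_plus_iff (hN : IsNodeSet s.top) {x : Finset V} (hx : x ∈ s.pureTop) :
    s.shrunk x ∈ (s.toTrad 𝓑).plus ↔ x ∈ s.plus := by
  simp only [toTrad, Finset.mem_image, Finset.mem_filter]
  constructor
  · rintro ⟨z, ⟨hz, hlabel⟩, h⟩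
    rwa [← shrunk_injOn hN hz hx h]
  · exact fun h => ⟨x, ⟨hx, h⟩, rfl⟩

theorem shrunk_mem_minus_iff (hN : IsNodeSet s.top) {x : Finset V} (hx : x ∈ s.pureTop) :
    s.shrunk x ∈ (s.toTrad 𝓑).minus ↔ x ∈ s.minus := by
  simp only [toTrad, Finset.mem_image, Finset.mem_filter]
  constructor
  · rintro ⟨z, ⟨hz, hlabel⟩, h⟩
    rwa [← shrunk_injOn hN hz hx h]
  · exact fun h => ⟨x, ⟨hx, h⟩, rfl⟩

theorem plusParent_shrunk (hN : IsNodeSet s.top) {x : Finset V} (hx : x ∈ s.pureTop) :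
    (s.toTrad 𝓑).plusParent (s.shrunk x) = s.plusParent x :=
  congrArg s.plusParent (unshrunk_shrunk hN hx)

theorem minusParent_shrunk (hN : IsNodeSet s.top) {x : Finset V} (hx : x ∈ s.pureTop) :
    (s.toTrad 𝓑).minusParent (s.shrunk x) = s.minusParent x :=
  congrArg s.minusParent (unshrunk_shrunk hN hx)

theorem realizedBy_toTrad (hN : IsNodeSet s.top) (hB : s.blossoms ⊆ 𝓑)
    (htop : topNodes 𝓑 = s.pureTop.image s.shrunk) : s.RealizedBy (s.toTrad 𝓑) where
  M := rfl
  y := rfl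
  blossoms := hB
  top := htop
  plus _ hx := shrunk_mem_plus_iff hN hx
  minus _ hx := shrunk_mem_minus_iff hN hx
  plusParent _ hx := plusParent_shrunk hN hx
  minusParent _ hx := minusParent_shrunk hN hx

theorem altPath_toTrad_of_plusMinus (hF : s.IsCherryForest H s.top) {v v' : Finset V}
    {b b' c : Bool} {l : List (Finset V)} (hpm : v ∈ s.plus ∧ v ∈ s.minus)
    (h : s.AltPath s.top v b (v :: l)) (hl : s.AltPath s.top v' b' l)
    (ih : (s.toTrad 𝓑).AltPath (s.pureTop.image s.shrunk) (s.shrunk (s.base v')) c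
      ((l.filter fun u => u ∈ s.pureTop).map s.shrunk)) :
    (s.toTrad 𝓑).AltPath (s.pureTop.image s.shrunk) (s.shrunk (s.base v)) c
      (((v :: l).filter fun u => u ∈ s.pureTop).map s.shrunk) := by
  have hv : v ∉ s.pureTop := fun hv => (mem_pureTop.1 hv).2 hpm
  rwa [base_eq_of_altPath hF hpm.1 hpm.2 h hl, List.filter_cons_of_neg (by simpa using hv)]

/-- The image of a path consists of its pure nodes. The `±`-nodes before the first of these are
absorbed by the cherry blossom of that node, at which the path arrives through a matched edge and
which it leaves by its plus-parent. -/
theorem altPath_toTrad (hF : s.IsCherryForest H s.top) (hN : IsNodeSet s.top) {v : Finset V}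
    {b : Bool} {l : List (Finset V)} (h : s.AltPath s.top v b l) :
    (s.toTrad 𝓑).AltPath (s.pureTop.image s.shrunk) (s.shrunk (s.base v))
      (if v ∈ s.plus ∧ v ∈ s.minus then true else b)
      ((l.filter fun u => u ∈ s.pureTop).map s.shrunk) := by
  induction h with
  | root r hr =>
    have hr' := mem_pureTop_of_isRoot hF hr
    rw [if_neg (mem_pureTop.1 hr').2, base_eq_self hr',
      List.filter_cons_of_pos (by simpa using hr')]
    exact AltPath.root _ ((isRoot_shrunk_iff hF hN hr').2 hr)
  | plus v v' l hv hp hr hv' h2 hl ih =>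
    have hmate := hF.mates_plusParent hN hv hp hr hv' h2
    by_cases hpm : v ∈ s.plus ∧ v ∈ s.minus
    · obtain ⟨hp', hm', -⟩ := hF.mate_plusMinus hN hv hp hpm.2 hv' hmate
      rw [if_pos ⟨hp', hm'⟩] at ih
      rw [if_pos hpm]
      exact altPath_toTrad_of_plusMinus hF hpm (AltPath.plus v v' l hv hp hr hv' h2 hl) hl ih
    · have hvp : v ∈ s.pureTop := mem_pureTop.2 ⟨hv, hpm⟩
      have hvp' := mate_mem_pureTop hF hN hvp hv' hmate
      rw [if_neg (mem_pureTop.1 hvp').2, base_eq_self hvp'] at ih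
      rw [if_neg hpm, base_eq_self hvp, List.filter_cons_of_pos (by simpa using hvp),
        List.map_cons]
      refine AltPath.plus _ _ _ (Finset.mem_image_of_mem _ hvp)
        ((shrunk_mem_plus_iff hN hvp).2 hp) (fun h => hr ((isRoot_shrunk_iff hF hN hvp).1 h))
        (Finset.mem_image_of_mem _ hvp') ?_ ih
      rw [plusParent_shrunk hN hvp]
      exact subset_shrunk v' h2
  | minus v v' l hv hm hv' h2 hl ih =>
    rw [ite_self] at ih
    by_cases hpm : v ∈ s.plus ∧ v ∈ s.minus
    · rw [if_pos hpm]
      exact altPath_toTrad_of_plusMinus hF hpm (AltPath.minus v v' l hv hm hv' h2 hl) hl ih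
    · have hvp : v ∈ s.pureTop := mem_pureTop.2 ⟨hv, hpm⟩
      rw [if_neg hpm, base_eq_self hvp, List.filter_cons_of_pos (by simpa using hvp),
        List.map_cons]
      refine AltPath.minus _ _ _ (Finset.mem_image_of_mem _ hvp)
        ((shrunk_mem_minus_iff hN hvp).2 hm)
        (Finset.mem_image_of_mem _ (base_mem_pureTop hF hv')) ?_ ih
      rw [minusParent_shrunk hN hvp]
      exact (mem_shrunk_iff hN (base_mem_pureTop hF hv') hv' h2).2 rfl

theorem nodup_map_shrunk (hN : IsNodeSet s.top) {l : List (Finset V)} (hl : l.Nodup) :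
    ((l.filter fun u => u ∈ s.pureTop).map s.shrunk).Nodup := by
  refine List.Nodup.map_on (fun x hx z hz h => ?_) (hl.filter _)
  rw [List.mem_filter, decide_eq_true_eq] at hx hz
  exact shrunk_injOn hN hx.2 hz.2 h

theorem plusParent_toTrad (hF : s.IsCherryForest H s.top) (hN : IsNodeSet s.top) {x : Finset V}
    (hx : x ∈ s.pureTop) (hp : x ∈ s.plus) (hr : ¬ s.IsRoot s.top x) :
    ((s.toTrad 𝓑).plusParent (s.shrunk x)).1 ∈ s.shrunk x ∧
      (∃ v ∈ s.pureTop.image s.shrunk, v ≠ s.shrunk x ∧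
        ((s.toTrad 𝓑).plusParent (s.shrunk x)).2 ∈ v) ∧
      H.Adj ((s.toTrad 𝓑).plusParent (s.shrunk x)).1 ((s.toTrad 𝓑).plusParent (s.shrunk x)).2 ∧
      s(((s.toTrad 𝓑).plusParent (s.shrunk x)).1, ((s.toTrad 𝓑).plusParent (s.shrunk x)).2)
        ∈ s.M := by
  have hxt := (mem_pureTop.1 hx).1
  obtain ⟨h1, ⟨v, hv, hvx, hv2⟩, hadj, hM⟩ := hF.plusParent x hxt hp hr
  have hvp := mate_mem_pureTop hF hN hx hv (hF.mates_plusParent hN hxt hp hr hv hv2)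
  rw [plusParent_shrunk hN hx]
  exact ⟨subset_shrunk x h1, ⟨_, Finset.mem_image_of_mem _ hvp,
    fun h => hvx (shrunk_injOn hN hvp hx h), subset_shrunk v hv2⟩, hadj, hM⟩

theorem minusParent_toTrad (hF : s.IsCherryForest H s.top) (hN : IsNodeSet s.top) {x : Finset V}
    (hx : x ∈ s.pureTop) (hm : x ∈ s.minus) :
    ((s.toTrad 𝓑).minusParent (s.shrunk x)).1 ∈ s.shrunk x ∧
      (∃ v ∈ s.pureTop.image s.shrunk, v ≠ s.shrunk x ∧
        ((s.toTrad 𝓑).minusParent (s.shrunk x)).2 ∈ v) ∧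
      H.Adj ((s.toTrad 𝓑).minusParent (s.shrunk x)).1
        ((s.toTrad 𝓑).minusParent (s.shrunk x)).2 ∧
      s(((s.toTrad 𝓑).minusParent (s.shrunk x)).1, ((s.toTrad 𝓑).minusParent (s.shrunk x)).2)
        ∉ s.M := by
  obtain ⟨h1, ⟨v, hv, hvx, hv2⟩, hadj, hM⟩ := hF.minusParent x (mem_pureTop.1 hx).1 hm
  have hvp := base_mem_pureTop hF hv
  rw [minusParent_shrunk hN hx]
  refine ⟨subset_shrunk x h1, ⟨_, Finset.mem_image_of_mem _ hvp, fun h => hvx ?_,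
    (mem_shrunk_iff hN hvp hv hv2).2 rfl⟩, hadj, hM⟩
  have := (mem_cherryBlossom_iff hx hv).2 (shrunk_injOn hN hvp hx h)
  rwa [cherryBlossom_eq_singleton hF hm, Finset.mem_singleton] at this

theorem isForest_toTrad (hF : s.IsCherryForest H s.top) (hN : IsNodeSet s.top)
    (hM : s.IsMatching H (s.pureTop.image s.shrunk)) :
    (s.toTrad 𝓑).IsForest H (s.pureTop.image s.shrunk) where
  matching := hM
  root r hr := by
    obtain ⟨x, hx, rfl⟩ := Finset.mem_image.1 hr.1
    rw [shrunk_mem_plus_iff hN hx, shrunk_mem_minus_iff hN hx]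
    exact hF.root x ((isRoot_shrunk_iff hF hN hx).1 hr)
  plusParent u hu hp hr := by
    obtain ⟨x, hx, rfl⟩ := Finset.mem_image.1 hu
    exact plusParent_toTrad hF hN hx ((shrunk_mem_plus_iff hN hx).1 hp)
      fun h => hr ((isRoot_shrunk_iff hF hN hx).2 h)
  minusParent u hu hm := by
    obtain ⟨x, hx, rfl⟩ := Finset.mem_image.1 hu
    exact minusParent_toTrad hF hN hx ((shrunk_mem_minus_iff hN hx).1 hm)
  plusPath u hu hp := by
    obtain ⟨x, hx, rfl⟩ := Finset.mem_image.1 hu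
    obtain ⟨l, hl, hnd⟩ := hF.plusPath x (mem_pureTop.1 hx).1 ((shrunk_mem_plus_iff hN hx).1 hp)
    have hpath := altPath_toTrad (𝓑 := 𝓑) hF hN hl
    rw [base_eq_self hx, ite_self] at hpath
    exact ⟨_, hpath, nodup_map_shrunk hN hnd⟩
  minusPath u hu hm := by
    obtain ⟨x, hx, rfl⟩ := Finset.mem_image.1 hu
    obtain ⟨l, hl, hnd⟩ := hF.minusPath x (mem_pureTop.1 hx).1
      ((shrunk_mem_minus_iff hN hx).1 hm)
    have hpath := altPath_toTrad (𝓑 := 𝓑) hF hN hl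
    rw [base_eq_self hx, if_neg (mem_pureTop.1 hx).2] at hpath
    exact ⟨_, hpath, nodup_map_shrunk hN hnd⟩

theorem noPlusMinus_toTrad (hN : IsNodeSet s.top) :
    (s.toTrad 𝓑).NoPlusMinus (s.pureTop.image s.shrunk) := by
  intro u hu h
  obtain ⟨x, hx, rfl⟩ := Finset.mem_image.1 hu
  rw [shrunk_mem_plus_iff hN hx, shrunk_mem_minus_iff hN hx] at h
  exact (mem_pureTop.1 hx).2 h

theorem minusMatched_toTrad (hF : s.IsCherryForest H s.top) (hN : IsNodeSet s.top)
    (h : s.MinusMatched s.top) : (s.toTrad 𝓑).MinusMatched (s.pureTop.image s.shrunk) := by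
  intro u hu hm
  obtain ⟨x, hx, rfl⟩ := Finset.mem_image.1 hu
  obtain ⟨v, hv, hp, hM⟩ := h x (mem_pureTop.1 hx).1 ((shrunk_mem_minus_iff hN hx).1 hm)
  have hvp := mate_mem_pureTop hF hN hx hv hM
  exact ⟨_, Finset.mem_image_of_mem _ hvp, (shrunk_mem_plus_iff hN hvp).2 hp,
    (mates_shrunk_iff hF hN hx hvp).2 hM⟩

theorem shrink_supernode {G : SimpleGraph V} {w : Sym2 V → ℝ} (hs : s.IsValid G w) {B : Finset V}
    (hB : B ∈ s.blossoms) :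
    Relation.ReflTransGen (OddCycleShrink (tightGraph G w s.y) s.M ∅) (children s.blossoms B)
      {B} := by
  obtain ⟨-, hF, r, hr, hpm⟩ := hs.supernode B hB
  have hN := hs.laminar.isNodeSet_children B
  have hCB : s.cherryBlossom (children s.blossoms B) r = children s.blossoms B := by
    refine Finset.Subset.antisymm (cherryBlossom_subset hr.1) fun u hu => ?_
    rw [CherryData.mem_cherryBlossom]
    by_cases hur : u = r
    · exact Or.inl hur
    obtain ⟨h1, h2⟩ := hpm u hu hur
    obtain ⟨hmem, -, hminus⟩ := hF.receptacle_plus u hu h1 h2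
    exact Or.inr ⟨hu, h1, h2, by_contra fun hne => hminus (hpm _ hmem hne).2⟩
  have := hF.shrink_cherryBlossom hN hr.1 (hF.root r hr).2
  rw [hCB, merge_children (hs.laminar.1 B hB)] at this
  exact Relation.ReflTransGen.mono (fun _ _ h => h.of_subset (Finset.empty_subset _)) _ _ this

theorem exists_realizedBy {G : SimpleGraph V} {w : Sym2 V → ℝ} (hs : s.IsValid G w) :
    ∃ t : TradState V, t.IsValid G w ∧ s.RealizedBy t := by
  have hF := hs.forest
  have hN : IsNodeSet s.top := hs.laminar.isNodeSet_topNodes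
  obtain ⟨𝓑₁, hsub₁, hlam₁, htop₁, htrad₁⟩ := hs.laminar.exists_refinement (D := s.toAltData)
    (H := tightGraph G w s.y)
    fun B hB => ⟨(hs.supernode B hB).2.1.matching, shrink_supernode hs hB⟩
  obtain ⟨𝓑, hsub, hlam, htop, hmatching, htrad⟩ :=
    hlam₁.exists_refinement_top (shrink_top hF hN) htop₁ hF.matching htrad₁
  replace htop : (s.toTrad 𝓑).top = s.pureTop.image s.shrunk := htop
  refine ⟨s.toTrad 𝓑, ⟨hlam, hs.feasible, fun S hS hS' => ?_, htrad, ?_, ?_, ?_⟩,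
    realizedBy_toTrad hN (hsub₁.trans hsub) htop⟩
  · exact hs.support S hS fun h => hS' (hsub (hsub₁ h))
  · exact htop ▸ isForest_toTrad hF hN hmatching
  · exact htop ▸ noPlusMinus_toTrad hN
  · exact htop ▸ minusMatched_toTrad hF hN hs.minusMatched

end CherryState

/-! ### Stuck states -/

namespace AltData

variable {V : Type*} {D D' : AltData V} {𝒩 : Finset (Finset V)}

/-- `D` and `D'` are the same on the graph with node set `𝒩`: outside `𝒩` labels and parents may
differ, so that a state of Blossom VI and its traditional realization can be compared. -/
structure Agree (D D' : AltData V) (𝒩 : Finset (Finset V)) : Prop where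
  M : D.M = D'.M
  plus : ∀ u ∈ 𝒩, u ∈ D.plus ↔ u ∈ D'.plus
  minus : ∀ u ∈ 𝒩, u ∈ D.minus ↔ u ∈ D'.minus
  plusParent : ∀ u ∈ 𝒩, D.plusParent u = D'.plusParent u
  minusParent : ∀ u ∈ 𝒩, D.minusParent u = D'.minusParent u

theorem Agree.symm (h : Agree D D' 𝒩) : Agree D' D 𝒩 :=
  ⟨h.M.symm, fun u hu => (h.plus u hu).symm, fun u hu => (h.minus u hu).symm,
    fun u hu => (h.plusParent u hu).symm, fun u hu => (h.minusParent u hu).symm⟩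

theorem Agree.mates (h : Agree D D' 𝒩) {u v : Finset V} : D.Mates u v ↔ D'.Mates u v := by
  unfold Mates
  rw [h.M]

theorem Agree.isRoot (h : Agree D D' 𝒩) {r : Finset V} : D.IsRoot 𝒩 r ↔ D'.IsRoot 𝒩 r := by
  unfold IsRoot
  simp only [h.mates]

theorem Agree.altPath (h : Agree D D' 𝒩) {v : Finset V} {b : Bool} {l : List (Finset V)}
    (hl : D.AltPath 𝒩 v b l) : D'.AltPath 𝒩 v b l := by
  induction hl with
  | root r hr => exact .root r (h.isRoot.1 hr)
  | plus v v' l hv hp hr hv' h2 _ ih =>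
    exact .plus v v' l hv ((h.plus v hv).1 hp) (fun h' => hr (h.isRoot.2 h')) hv'
      (h.plusParent v hv ▸ h2) ih
  | minus v v' l hv hm hv' h2 _ ih =>
    exact .minus v v' l hv ((h.minus v hv).1 hm) hv' (h.minusParent v hv ▸ h2) ih

theorem Agree.inTree (h : Agree D D' 𝒩) {r v : Finset V} :
    D.InTree 𝒩 r v ↔ D'.InTree 𝒩 r v :=
  ⟨fun ⟨b, l, h1, h2⟩ => ⟨b, l, h.altPath h1, h2⟩,
    fun ⟨b, l, h1, h2⟩ => ⟨b, l, h.symm.altPath h1, h2⟩⟩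

theorem InTree.mem {r v : Finset V} (h : D.InTree 𝒩 r v) : v ∈ 𝒩 := by
  obtain ⟨b, l, h1, -⟩ := h
  exact h1.mem

theorem Agree.isFree (h : Agree D D' 𝒩) {u : Finset V} (hu : u ∈ 𝒩) :
    D.IsFree u ↔ D'.IsFree u := by
  unfold IsFree
  rw [h.plus u hu, h.minus u hu]

theorem Agree.isDualUpdate (h : Agree D D' 𝒩) {δ y y' : Finset V → ℝ}
    (hu : D.IsDualUpdate 𝒩 δ y y') : D'.IsDualUpdate 𝒩 δ y y' := by
  obtain ⟨h1, h2, h3, h4⟩ := hu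
  refine ⟨fun r hr => h1 r (h.isRoot.2 hr), fun r hr => h2 r fun h' => hr (h.isRoot.1 h'),
    fun r u hru => ?_, fun S hS => h4 S fun r hr => hS r (h.inTree.1 hr)⟩
  rw [← h.plus u hru.mem, ← h.minus u hru.mem]
  exact h3 r u (h.inTree.2 hru)

theorem Agree.noPlusMinus (h : Agree D D' 𝒩) (hpm : D.NoPlusMinus 𝒩) : D'.NoPlusMinus 𝒩 := by
  intro u hu
  rw [← h.plus u hu, ← h.minus u hu]
  exact hpm u hu

theorem Agree.canGrow (h : Agree D D' 𝒩) {H : SimpleGraph V} (hg : D.CanGrow H 𝒩) :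
    D'.CanGrow H 𝒩 := by
  obtain ⟨v, hv, x, hx, z, hz, hp, hvx, hxz, hfx, hfz⟩ := hg
  exact ⟨v, hv, x, hx, z, hz, (h.plus v hv).1 hp, hvx, h.mates.1 hxz, (h.isFree hx).1 hfx,
    (h.isFree hz).1 hfz⟩

theorem Agree.canAugment (h : Agree D D' 𝒩) {H : SimpleGraph V} (ha : D.CanAugment H 𝒩) :
    D'.CanAugment H 𝒩 := by
  obtain ⟨u, hu, v, hv, hpu, hpv, huv, r, r', hr, hr', hne⟩ := ha
  exact ⟨u, hu, v, hv, (h.plus u hu).1 hpu, (h.plus v hv).1 hpv, huv, r, r', h.inTree.1 hr,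
    h.inTree.1 hr', hne⟩

theorem Agree.dualProgress [Fintype V] [DecidableEq V] (h : Agree D D' 𝒩) {G : SimpleGraph V}
    {w : Sym2 V → ℝ} {y : Finset V → ℝ} (hp : D.DualProgress G w 𝒩 y) :
    D'.DualProgress G w 𝒩 y := by
  obtain ⟨hpm, δ, ⟨y', hy', hf⟩, hpos, hmax⟩ := hp
  exact ⟨h.noPlusMinus hpm, δ, ⟨y', h.isDualUpdate hy', hf⟩, hpos,
    fun δ' ⟨z, hz, hzf⟩ => hmax δ' ⟨z, h.symm.isDualUpdate hz, hzf⟩⟩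

end AltData

namespace CherryState

open AltData CherryData

variable {V : Type*} [Fintype V] [DecidableEq V] {s : CherryState V} {G H : SimpleGraph V}
  {w : Sym2 V → ℝ}

theorem noPlusMinus_of_not_canShrink (hF : s.IsCherryForest H s.top) (h : ¬ s.CanShrink) :
    s.NoPlusMinus s.top := by
  intro u hu hpm
  obtain ⟨h1, h2, h3⟩ := hF.receptacle_plus u hu hpm.1 hpm.2
  refine h ⟨s.receptacle u, h1, h2, h3, fun heq => h3 ?_⟩
  have : u ∈ s.cherryBlossom s.top (s.receptacle u) :=
    CherryData.mem_cherryBlossom.2 (Or.inr ⟨hu, hpm.1, hpm.2, rfl⟩)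
  rw [heq, Finset.mem_singleton] at this
  exact this ▸ hpm.2

theorem IsStuck.noPlusMinus (hs : s.IsValid G w) (h : s.IsStuck G w) : s.NoPlusMinus s.top :=
  noPlusMinus_of_not_canShrink hs.forest fun h' => h.2.1 (Or.inr (Or.inr (Or.inr (Or.inl h'))))

theorem mem_blossoms_of_mem_top {S : Finset V} (hS : S ∈ s.top) (hcard : 1 < S.card) :
    S ∈ s.blossoms := by
  rcases mem_nodes.1 (Finset.mem_filter.1 hS).1 with ⟨v, rfl⟩ | h
  · simp at hcard
  · exact h

theorem RealizedBy.agree {t : TradState V} (h : s.RealizedBy t) (hpm : s.NoPlusMinus s.top) :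
    t.top = s.top ∧ Agree t.toAltData s.toAltData s.top := by
  have hpure : s.pureTop = s.top := by
    ext x
    rw [mem_pureTop]
    exact ⟨And.left, fun hx => ⟨hx, hpm x hx⟩⟩
  have hshr : ∀ x ∈ s.top, s.shrunk x = x := by
    intro x _
    rw [shrunk, CherryData.cherryBlossom, Finset.filter_eq_empty_iff.2]
    · exact merge_singleton x
    · exact fun v hv hv' => hpm v hv ⟨hv'.1, hv'.2.1⟩
  refine ⟨?_, h.M, fun u hu => ?_, fun u hu => ?_, fun u hu => ?_, fun u hu => ?_⟩
  · rw [h.top, hpure, Finset.image_congr (g := id) hshr, Finset.image_id]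
  · simpa only [hshr u hu] using h.plus u (hpure ▸ hu)
  · simpa only [hshr u hu] using h.minus u (hpure ▸ hu)
  · simpa only [hshr u hu] using h.plusParent u (hpure ▸ hu)
  · simpa only [hshr u hu] using h.minusParent u (hpure ▸ hu)

theorem RealizedBy.isStuck {t : TradState V} (h : s.RealizedBy t) (hs : s.IsValid G w)
    (ht : t.IsValid G w) (hst : s.IsStuck G w) : t.IsStuck G w := by
  have hpm := hst.noPlusMinus hs
  obtain ⟨htop, hag⟩ := h.agree hpm
  obtain ⟨⟨r, hr⟩, hprimal, hdual⟩ := hst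
  unfold TradState.IsStuck TradState.PrimalProgress TradState.CanShrink
  rw [htop, h.y]
  refine ⟨⟨r, hag.isRoot.2 hr⟩, fun hp => hprimal ?_, fun hd => hdual (hag.dualProgress hd)⟩
  rcases hp with hgrow | haugment | ⟨u, hu, v, hv, hne, hpu, hpv, huv, r, hru, hrv⟩ |
    ⟨v, hv, hm, hp, hblossom, hy⟩
  · exact Or.inl (hag.canGrow hgrow)
  · exact Or.inr (Or.inr (Or.inl (hag.canAugment haugment)))
  · refine Or.inr (Or.inl ⟨u, hu, v, hv, (hag.plus u hu).1 hpu, (hag.plus v hv).1 hpv, ?_, huv, r,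
      hag.inTree.1 hru, hag.inTree.1 hrv⟩)
    rwa [base_eq_self (mem_pureTop.2 ⟨hu, hpm u hu⟩), base_eq_self (mem_pureTop.2 ⟨hv, hpm v hv⟩)]
  · exact Or.inr (Or.inr (Or.inr (Or.inr ⟨v, hv, (hag.minus v hv).1 hm,
      fun hp' => hp ((hag.plus v hv).2 hp'),
      mem_blossoms_of_mem_top hv (ht.laminar.1 v hblossom), hy⟩)))

end CherryState

/-! ### Weak duality -/

theorem exists_notMem_of_odd {V : Type*} {m : V → V} (hinv : Function.Involutive m)
    (hne : ∀ v, m v ≠ v) {S : Finset V} (hS : Odd S.card) : ∃ v ∈ S, m v ∉ S := by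
  by_contra! h
  have hsum : ∑ _v ∈ S, (1 : ZMod 2) = 0 :=
    Finset.sum_involution (fun v _ => m v) (fun _ _ => by decide) (fun v _ _ => hne v)
      (fun v hv => h v hv) (fun v _ => hinv v)
  rw [Finset.sum_const, nsmul_eq_mul, mul_one, ZMod.natCast_eq_zero_iff_even] at hsum
  exact Nat.not_even_iff_odd.2 hS hsum

theorem eq_singleton_of_odd_card {V : Type*} {S : Finset V} (hS : Odd S.card) (h : ¬ 1 < S.card) :
    ∃ v, S = {v} :=
  Finset.card_eq_one.1 (le_antisymm (not_lt.1 h) hS.pos)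

section Duality

variable {V : Type*} [Fintype V] [DecidableEq V]

/-- The variables of the two ends of the edge are those of the singletons that separate them. -/
theorem slack_eq_sum (w : Sym2 V → ℝ) (y : Finset V → ℝ) {a b : V} (hab : a ≠ b) :
    slack w y a b = w s(a, b) -
      ∑ S : Finset V with Odd S.card ∧ (a ∈ S ∧ b ∉ S ∨ b ∈ S ∧ a ∉ S), y S := by
  have hset : (Finset.univ.filter fun S : Finset V =>
      Odd S.card ∧ (a ∈ S ∧ b ∉ S ∨ b ∈ S ∧ a ∉ S)) = insert {a} (insert {b}
        (Finset.univ.filter fun S : Finset V =>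
          Odd S.card ∧ 1 < S.card ∧ (a ∈ S ∧ b ∉ S ∨ b ∈ S ∧ a ∉ S))) := by
    ext S
    simp only [Finset.mem_filter, Finset.mem_univ, true_and, Finset.mem_insert]
    constructor
    · rintro ⟨hodd, hsep⟩
      by_cases hcard : 1 < S.card
      · exact Or.inr (Or.inr ⟨hodd, hcard, hsep⟩)
      · obtain ⟨v, rfl⟩ := eq_singleton_of_odd_card hodd hcard
        simp only [Finset.mem_singleton] at hsep
        rcases hsep with ⟨rfl, -⟩ | ⟨rfl, -⟩
        · exact Or.inl rfl
        · exact Or.inr (Or.inl rfl)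
    · rintro (rfl | rfl | ⟨hodd, -, hsep⟩)
      · simp [hab.symm]
      · simp [hab]
      · exact ⟨hodd, hsep⟩
  have hne : ({a} : Finset V) ≠ {b} := fun h => hab (Finset.singleton_inj.1 h)
  rw [hset, Finset.sum_insert (by simp [hne]), Finset.sum_insert (by simp), slack]
  ring

/-- The vertices whose edge `v (m v)` leaves `S`, for a perfect matching given by the map `m` from
each vertex to its mate; each matched edge of the cut `δ(S)` is counted at both ends. -/
def crossing (m : V → V) (S : Finset V) : Finset V :=
  Finset.univ.filter fun v => v ∈ S ∧ m v ∉ S ∨ m v ∈ S ∧ v ∉ S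

theorem sum_slack_eq (w : Sym2 V → ℝ) (y : Finset V → ℝ) {m : V → V} (hne : ∀ v, m v ≠ v) :
    ∑ v, slack w y v (m v) =
      ∑ v, w s(v, m v) - ∑ S : Finset V with Odd S.card, ((crossing m S).card : ℝ) * y S := by
  simp only [slack_eq_sum w y (hne _).symm, Finset.sum_sub_distrib, crossing, Finset.sum_filter,
    Finset.card_filter, Nat.cast_sum, Finset.sum_mul]
  rw [Finset.sum_comm]
  congr 1
  refine Finset.sum_congr rfl fun S _ => ?_
  by_cases hS : Odd S.card <;> simp [hS]

theorem two_le_card_crossing {m : V → V} (hinv : Function.Involutive m) (hne : ∀ v, m v ≠ v)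
    {S : Finset V} (hS : Odd S.card) : 2 ≤ (crossing m S).card := by
  obtain ⟨v, hv, hmv⟩ := exists_notMem_of_odd hinv hne hS
  rw [← Finset.card_pair (hne v).symm]
  refine Finset.card_le_card (Finset.insert_subset ?_ (Finset.singleton_subset_iff.2 ?_))
  · simp [crossing, hv, hmv]
  · simp [crossing, hinv v, hv, hmv]

theorem crossing_singleton {m : V → V} (hinv : Function.Involutive m) (hne : ∀ v, m v ≠ v)
    (v : V) : crossing m {v} = {v, m v} := by
  ext u
  simp only [crossing, Finset.mem_filter, Finset.mem_univ, true_and, Finset.mem_singleton,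
    Finset.mem_insert]
  constructor
  · rintro (⟨h, -⟩ | ⟨h, -⟩)
    · exact Or.inl h
    · exact Or.inr (by rw [← h, hinv])
  · rintro (rfl | rfl)
    · exact Or.inl ⟨rfl, hne u⟩
    · exact Or.inr ⟨hinv v, hne v⟩

/-- The variable of a single vertex may be negative, but there the two sides are equal. -/
theorem two_mul_le_card_crossing_mul {m : V → V} (hinv : Function.Involutive m)
    (hne : ∀ v, m v ≠ v) {y : Finset V → ℝ}
    (hy : ∀ S : Finset V, Odd S.card → 1 < S.card → 0 ≤ y S) {S : Finset V} (hS : Odd S.card) :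
    2 * y S ≤ (crossing m S).card * y S := by
  by_cases hcard : 1 < S.card
  · exact mul_le_mul_of_nonneg_right (mod_cast two_le_card_crossing hinv hne hS) (hy S hS hcard)
  · obtain ⟨v, rfl⟩ := eq_singleton_of_odd_card hS hcard
    rw [crossing_singleton hinv hne, Finset.card_pair (hne v).symm, Nat.cast_two]

theorem exists_dual_bound {G : SimpleGraph V} {w : Sym2 V → ℝ} {N : G.Subgraph}
    (hN : N.IsPerfectMatching) :
    ∃ K : ℝ, ∀ y, DualFeasible G w y → ∑ S : Finset V with Odd S.card, y S ≤ K := by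
  choose m hm hm' using fun v => hN.1 (hN.2 v)
  have hinv : Function.Involutive m := fun v => (hm' (m v) v (hm v).symm).symm
  have hne : ∀ v, m v ≠ v := fun v h => (hm v).ne h.symm
  refine ⟨(∑ v, w s(v, m v)) / 2, fun y hy => ?_⟩
  have hslack : 0 ≤ ∑ v, slack w y v (m v) :=
    Finset.sum_nonneg fun v _ => hy.1 v (m v) (hm v).adj_sub
  rw [sum_slack_eq w y hne] at hslack
  have hcut : ∑ S : Finset V with Odd S.card, 2 * y S ≤
      ∑ S : Finset V with Odd S.card, ((crossing m S).card : ℝ) * y S :=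
    Finset.sum_le_sum fun S hS =>
      two_mul_le_card_crossing_mul hinv hne hy.2 (Finset.mem_filter.1 hS).2
  rw [← Finset.mul_sum] at hcut
  linarith

end Duality

/-! ### Dual updates -/

namespace AltData

variable {V : Type*} {D : AltData V} {H : SimpleGraph V} {𝒩 : Finset (Finset V)}

theorem AltPath.getLast?_cons {v : Finset V} {b : Bool} {l : List (Finset V)}
    (h : D.AltPath 𝒩 v b l) (u : Finset V) : (u :: l).getLast? = l.getLast? := by
  obtain ⟨l', rfl⟩ := h.exists_eq_cons
  exact List.getLast?_cons_cons

theorem AltPath.exists_root {v : Finset V} {b : Bool} {l : List (Finset V)}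
    (h : D.AltPath 𝒩 v b l) : ∃ r, l.getLast? = some r ∧ D.IsRoot 𝒩 r := by
  induction h with
  | root r hr => exact ⟨r, rfl, hr⟩
  | plus _ _ _ _ _ _ _ _ hl ih => rwa [hl.getLast?_cons]
  | minus _ _ _ _ _ _ _ hl ih => rwa [hl.getLast?_cons]

theorem InTree.isRoot {r v : Finset V} (h : D.InTree 𝒩 r v) : D.IsRoot 𝒩 r := by
  obtain ⟨b, l, h1, h2⟩ := h
  obtain ⟨r', h3, h4⟩ := h1.exists_root
  rw [h2] at h3
  exact Option.some.inj h3 ▸ h4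

theorem IsForest.exists_inTree (hF : D.IsForest H 𝒩) {v : Finset V} (hv : v ∈ 𝒩)
    (hl : v ∈ D.plus ∨ v ∈ D.minus) : ∃ r, D.InTree 𝒩 r v := by
  rcases hl with h | h
  · obtain ⟨l, h1, -⟩ := hF.plusPath v hv h
    obtain ⟨r, h2, -⟩ := h1.exists_root
    exact ⟨r, _, l, h1, h2⟩
  · obtain ⟨l, h1, -⟩ := hF.minusPath v hv h
    obtain ⟨r, h2, -⟩ := h1.exists_root
    exact ⟨r, _, l, h1, h2⟩

theorem IsForest.mem_plus_or_mem_minus_of_inTree (hF : D.IsForest H 𝒩) {r v : Finset V}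
    (h : D.InTree 𝒩 r v) : v ∈ D.plus ∨ v ∈ D.minus := by
  obtain ⟨b, l, h1, -⟩ := h
  cases b with
  | true => exact Or.inl (hF.mem_plus_of_altPath h1)
  | false => exact Or.inr h1.mem_minus

theorem IsForest.inTree_unique (hF : D.IsForest H 𝒩) (hN : IsNodeSet 𝒩) (hpm : D.NoPlusMinus 𝒩)
    {r r' v : Finset V} (h : D.InTree 𝒩 r v) (h' : D.InTree 𝒩 r' v) : r = r' := by
  have hno := hpm v h.mem
  obtain ⟨b, l, h1, h2⟩ := h
  obtain ⟨b', l', h1', h2'⟩ := h'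
  have hb : b = b' := by
    cases b <;> cases b'
    · rfl
    · exact (hno ⟨hF.mem_plus_of_altPath h1', h1.mem_minus⟩).elim
    · exact (hno ⟨hF.mem_plus_of_altPath h1, h1'.mem_minus⟩).elim
    · rfl
  subst hb
  rw [h1.deterministic hN h1', h2'] at h2
  exact (Option.some.inj h2).symm

theorem IsRoot.inTree_self {r : Finset V} (h : D.IsRoot 𝒩 r) : D.InTree 𝒩 r r :=
  ⟨true, [r], .root r h, rfl⟩

open Classical in
/-- The root of the tree that contains `v`, a junk value if `v` lies in no tree. -/
noncomputable def treeRoot (D : AltData V) (𝒩 : Finset (Finset V)) (v : Finset V) : Finset V :=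
  if h : ∃ r, D.InTree 𝒩 r v then h.choose else v

theorem inTree_treeRoot {v : Finset V} (h : ∃ r, D.InTree 𝒩 r v) :
    D.InTree 𝒩 (D.treeRoot 𝒩 v) v := by
  rw [treeRoot, dif_pos h]
  exact h.choose_spec

theorem IsForest.treeRoot_eq (hF : D.IsForest H 𝒩) (hN : IsNodeSet 𝒩) (hpm : D.NoPlusMinus 𝒩)
    {r v : Finset V} (h : D.InTree 𝒩 r v) : D.treeRoot 𝒩 v = r :=
  hF.inTree_unique hN hpm (inTree_treeRoot ⟨r, h⟩) h

theorem IsForest.exists_inTree_mates (hF : D.IsForest H 𝒩) (hN : IsNodeSet 𝒩) {u v : Finset V}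
    (hu : u ∈ 𝒩) (hv : v ∈ 𝒩) (hp : v ∈ D.plus) (h : D.Mates u v) :
    ∃ r, D.InTree 𝒩 r u ∧ D.InTree 𝒩 r v := by
  obtain ⟨l, hvl, hl⟩ := hF.exists_altPath_cons_of_mates hN hv hp hu h.symm
  obtain ⟨r, hr, -⟩ := hl.exists_root
  exact ⟨r, ⟨false, l, hl, hr⟩, true, v :: l, hvl, (hl.getLast?_cons v).trans hr⟩

theorem IsForest.treeRoot_eq_of_mates (hF : D.IsForest H 𝒩) (hN : IsNodeSet 𝒩)
    (hpm : D.NoPlusMinus 𝒩) {u v : Finset V} (hu : u ∈ 𝒩) (hv : v ∈ 𝒩) (hp : v ∈ D.plus)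
    (h : D.Mates u v) : D.treeRoot 𝒩 u = D.treeRoot 𝒩 v := by
  obtain ⟨r, hru, hrv⟩ := hF.exists_inTree_mates hN hu hv hp h
  rw [hF.treeRoot_eq hN hpm hru, hF.treeRoot_eq hN hpm hrv]

open Classical in
/-- The sign with which the dual variable of `S` changes in a dual update. -/
noncomputable def sign (D : AltData V) (𝒩 : Finset (Finset V)) (S : Finset V) : ℝ :=
  if S ∈ 𝒩 ∧ S ∈ D.plus then 1 else if S ∈ 𝒩 ∧ S ∈ D.minus then -1 else 0

theorem sign_plus {S : Finset V} (hS : S ∈ 𝒩) (h : S ∈ D.plus) : D.sign 𝒩 S = 1 :=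
  if_pos ⟨hS, h⟩

theorem sign_minus {S : Finset V} (hS : S ∈ 𝒩) (hpm : D.NoPlusMinus 𝒩) (h : S ∈ D.minus) :
    D.sign 𝒩 S = -1 := by
  rw [sign, if_neg fun h' => hpm S hS ⟨h'.2, h⟩, if_pos ⟨hS, h⟩]

theorem sign_eq_zero {S : Finset V} (h : ¬ (S ∈ 𝒩 ∧ (S ∈ D.plus ∨ S ∈ D.minus))) :
    D.sign 𝒩 S = 0 := by
  rw [sign, if_neg fun h' => h ⟨h'.1, Or.inl h'.2⟩, if_neg fun h' => h ⟨h'.1, Or.inr h'.2⟩]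

/-- The result of the dual update with steps `δ`. -/
noncomputable def dualStep (D : AltData V) (𝒩 : Finset (Finset V)) (y δ : Finset V → ℝ)
    (S : Finset V) : ℝ :=
  y S + D.sign 𝒩 S * δ (D.treeRoot 𝒩 S)

theorem IsForest.isDualUpdate_iff (hF : D.IsForest H 𝒩) (hN : IsNodeSet 𝒩)
    (hpm : D.NoPlusMinus 𝒩) {δ y y' : Finset V → ℝ} :
    D.IsDualUpdate 𝒩 δ y y' ↔ (∀ r, D.IsRoot 𝒩 r → 0 ≤ δ r) ∧
      (∀ r, ¬ D.IsRoot 𝒩 r → δ r = 0) ∧ y' = D.dualStep 𝒩 y δ := by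
  constructor
  · rintro ⟨h1, h2, h3, h4⟩
    refine ⟨h1, h2, funext fun S => ?_⟩
    by_cases hS : ∃ r, D.InTree 𝒩 r S
    · have hr := inTree_treeRoot hS
      rcases hF.mem_plus_or_mem_minus_of_inTree hr with h | h
      · rw [(h3 _ S hr).1 h, dualStep, sign_plus hr.mem h, one_mul]
      · rw [(h3 _ S hr).2 h, dualStep, sign_minus hr.mem hpm h]
        ring
    · rw [h4 S fun r hr => hS ⟨r, hr⟩, dualStep, sign_eq_zero, zero_mul, add_zero]
      exact fun h => hS (hF.exists_inTree h.1 h.2)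
  · rintro ⟨h1, h2, rfl⟩
    refine ⟨h1, h2, fun r u hr => ?_, fun S hS => ?_⟩
    · rw [dualStep, hF.treeRoot_eq hN hpm hr]
      constructor
      · intro h
        rw [sign_plus hr.mem h, one_mul]
      · intro h
        rw [sign_minus hr.mem hpm h]
        ring
    · rw [dualStep, sign_eq_zero, zero_mul, add_zero]
      intro h
      obtain ⟨r, hr⟩ := hF.exists_inTree h.1 h.2
      exact hS r hr

open Classical in
theorem IsForest.sum_minus_eq_sum_plus {R : Type*} [AddCommMonoid R] (hF : D.IsForest H 𝒩)
    (hN : IsNodeSet 𝒩) (hmm : D.MinusMatched 𝒩) {f : Finset V → R}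
    (hf : ∀ u ∈ 𝒩, ∀ v ∈ 𝒩, v ∈ D.plus → D.Mates u v → f u = f v) :
    ∑ u ∈ 𝒩 with u ∈ D.minus, f u = ∑ v ∈ 𝒩 with v ∈ D.plus ∧ ¬ D.IsRoot 𝒩 v, f v := by
  choose! m hm hplus hmates using hmm
  refine Finset.sum_bij (fun u _ => m u) ?_ ?_ ?_ ?_
  · intro u hu
    obtain ⟨hu, hum⟩ := Finset.mem_filter.1 hu
    exact Finset.mem_filter.2 ⟨hm u hu hum, hplus u hu hum,
      fun hr => hr.2 u hu (hmates u hu hum).symm⟩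
  · intro u hu u' hu' h
    obtain ⟨hu, hum⟩ := Finset.mem_filter.1 hu
    obtain ⟨hu', hum'⟩ := Finset.mem_filter.1 hu'
    exact hF.matching.mates_unique hN (hm u hu hum) hu hu' (hmates u hu hum).symm
      (h ▸ (hmates u' hu' hum').symm)
  · intro v hv
    obtain ⟨hv, hvp, hvr⟩ := Finset.mem_filter.1 hv
    obtain ⟨-, ⟨u, hu, -, hvu⟩, -⟩ := hF.plusParent v hv hvp hvr
    have hM := hF.mates_plusParent hN hv hvp hvr hu hvu
    obtain ⟨l, -, hl⟩ := hF.exists_altPath_cons_of_mates hN hv hvp hu hM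
    have hum := hl.mem_minus
    exact ⟨u, Finset.mem_filter.2 ⟨hu, hum⟩,
      hF.matching.mates_unique hN hu (hm u hu hum) hv (hmates u hu hum) hM.symm⟩
  · intro u hu
    obtain ⟨hu, hum⟩ := Finset.mem_filter.1 hu
    exact hf u hu (m u) (hm u hu hum) (hplus u hu hum) (hmates u hu hum)

open Classical in
theorem IsForest.sign_mul (hF : D.IsForest H 𝒩) (hpm : D.NoPlusMinus 𝒩) {S : Finset V}
    (hS : S ∈ 𝒩) (c : ℝ) :
    D.sign 𝒩 S * c = (if D.IsRoot 𝒩 S then c else 0) +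
      ((if S ∈ D.plus ∧ ¬ D.IsRoot 𝒩 S then c else 0) - if S ∈ D.minus then c else 0) := by
  by_cases hr : D.IsRoot 𝒩 S
  · obtain ⟨hp, hm⟩ := hF.root S hr
    simp [sign_plus hS hp, hr, hm]
  by_cases hp : S ∈ D.plus
  · have hm : S ∉ D.minus := fun hm => hpm S hS ⟨hp, hm⟩
    simp [sign_plus hS hp, hr, hp, hm]
  by_cases hm : S ∈ D.minus
  · simp [sign_minus hS hpm hm, hr, hp, hm]
  · rw [sign_eq_zero fun h => h.2.elim hp hm]
    simp [hr, hp, hm]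

section Objective

variable [Fintype V]

open Classical in
theorem IsForest.sum_sign_mul_treeRoot (hF : D.IsForest H 𝒩) (hN : IsNodeSet 𝒩)
    (hpm : D.NoPlusMinus 𝒩) (hmm : D.MinusMatched 𝒩) {δ : Finset V → ℝ}
    (hδ : ∀ r, ¬ D.IsRoot 𝒩 r → δ r = 0) :
    ∑ S ∈ 𝒩, D.sign 𝒩 S * δ (D.treeRoot 𝒩 S) = ∑ r, δ r := by
  have hmates := hF.sum_minus_eq_sum_plus hN hmm (f := fun S => δ (D.treeRoot 𝒩 S))
    fun u hu v hv hp h => congrArg δ (hF.treeRoot_eq_of_mates hN hpm hu hv hp h)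
  have hroots : ∑ S ∈ 𝒩 with D.IsRoot 𝒩 S, δ (D.treeRoot 𝒩 S) = ∑ r, δ r := by
    refine (Finset.sum_congr rfl fun S hS => ?_).trans
      (Finset.sum_subset (Finset.subset_univ _) fun r _ hr => ?_)
    · rw [hF.treeRoot_eq hN hpm (Finset.mem_filter.1 hS).2.inTree_self]
    · exact hδ r fun h => hr (Finset.mem_filter.2 ⟨h.1, h⟩)
  rw [Finset.sum_congr rfl fun S hS => hF.sign_mul hpm hS _, Finset.sum_add_distrib,
    Finset.sum_sub_distrib, ← Finset.sum_filter, ← Finset.sum_filter, ← Finset.sum_filter,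
    hmates, sub_self, add_zero, hroots]

/-- In every tree the plus-nodes other than the root cancel against their mates, so that only the
root contributes. -/
theorem IsForest.sum_dualStep (hF : D.IsForest H 𝒩) (hN : IsNodeSet 𝒩) (hpm : D.NoPlusMinus 𝒩)
    (hmm : D.MinusMatched 𝒩) (hodd : ∀ S ∈ 𝒩, Odd S.card) (y : Finset V → ℝ) {δ : Finset V → ℝ}
    (hδ : ∀ r, ¬ D.IsRoot 𝒩 r → δ r = 0) :
    ∑ S : Finset V with Odd S.card, D.dualStep 𝒩 y δ S =
      ∑ S : Finset V with Odd S.card, y S + ∑ r, δ r := by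
  simp only [dualStep, Finset.sum_add_distrib]
  rw [← hF.sum_sign_mul_treeRoot hN hpm hmm hδ]
  congr 1
  refine (Finset.sum_subset (fun S hS => by simpa using hodd S hS) fun S _ hS => ?_).symm
  rw [sign_eq_zero fun h => hS h.1, zero_mul]

end Objective

section Progress

variable [Fintype V] [DecidableEq V]

theorem continuous_slack_dualStep (w : Sym2 V → ℝ) (y : Finset V → ℝ) (a b : V) :
    Continuous fun δ : Finset V → ℝ => slack w (D.dualStep 𝒩 y δ) a b := by
  unfold slack dualStep
  fun_prop

theorem isClosed_dualFeasible (G : SimpleGraph V) (w : Sym2 V → ℝ) (y : Finset V → ℝ) :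
    IsClosed {δ : Finset V → ℝ | DualFeasible G w (D.dualStep 𝒩 y δ)} := by
  simp only [DualFeasible, Set.ofPred_and, Set.ofPred_forall]
  refine IsClosed.inter ?_ ?_
  · exact isClosed_iInter fun a => isClosed_iInter fun b => isClosed_iInter fun _ =>
      isClosed_le continuous_const (continuous_slack_dualStep w y a b)
  · refine isClosed_iInter fun S => isClosed_iInter fun _ => isClosed_iInter fun _ =>
      isClosed_le continuous_const ?_
    unfold dualStep
    fun_prop

theorem IsForest.isFeasibleStep_iff (hF : D.IsForest H 𝒩) (hN : IsNodeSet 𝒩)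
    (hpm : D.NoPlusMinus 𝒩) {G : SimpleGraph V} {w : Sym2 V → ℝ} {y δ : Finset V → ℝ} :
    D.IsFeasibleStep G w 𝒩 y δ ↔ (∀ r, 0 ≤ δ r) ∧ (∀ r, ¬ D.IsRoot 𝒩 r → δ r = 0) ∧
      DualFeasible G w (D.dualStep 𝒩 y δ) := by
  simp only [IsFeasibleStep, hF.isDualUpdate_iff hN hpm]
  constructor
  · rintro ⟨y', ⟨hroot, hnot, rfl⟩, hf⟩
    refine ⟨fun r => ?_, hnot, hf⟩
    by_cases hr : D.IsRoot 𝒩 r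
    · exact hroot r hr
    · exact (hnot r hr).ge
  · rintro ⟨hnonneg, hnot, hf⟩
    exact ⟨_, ⟨fun r _ => hnonneg r, hnot, rfl⟩, hf⟩

theorem IsForest.isClosed_isFeasibleStep (hF : D.IsForest H 𝒩) (hN : IsNodeSet 𝒩)
    (hpm : D.NoPlusMinus 𝒩) (G : SimpleGraph V) (w : Sym2 V → ℝ) (y : Finset V → ℝ) :
    IsClosed {δ | D.IsFeasibleStep G w 𝒩 y δ} := by
  simp only [hF.isFeasibleStep_iff hN hpm, Set.ofPred_and, Set.ofPred_forall]
  refine IsClosed.inter ?_ (IsClosed.inter ?_ (isClosed_dualFeasible G w y))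
  · exact isClosed_iInter fun r => isClosed_le continuous_const (continuous_apply r)
  · exact isClosed_iInter fun r => isClosed_iInter fun _ =>
      isClosed_eq (continuous_apply r) continuous_const

theorem IsForest.isCompact_isFeasibleStep (hF : D.IsForest H 𝒩) (hN : IsNodeSet 𝒩)
    (hpm : D.NoPlusMinus 𝒩) (hmm : D.MinusMatched 𝒩) (hodd : ∀ S ∈ 𝒩, Odd S.card)
    {G : SimpleGraph V} {w : Sym2 V → ℝ} (y : Finset V → ℝ) {K : ℝ}
    (hK : ∀ y, DualFeasible G w y → ∑ S : Finset V with Odd S.card, y S ≤ K) :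
    IsCompact {δ | D.IsFeasibleStep G w 𝒩 y δ} := by
  refine IsCompact.of_isClosed_subset (isCompact_Icc (a := (0 : Finset V → ℝ))
    (b := fun _ => K - ∑ S : Finset V with Odd S.card, y S))
    (hF.isClosed_isFeasibleStep hN hpm G w y) fun δ hδ => ?_
  obtain ⟨hnonneg, hnot, hf⟩ := (hF.isFeasibleStep_iff hN hpm).1 hδ
  have hsum := hK _ hf
  rw [hF.sum_dualStep hN hpm hmm hodd y hnot] at hsum
  exact ⟨hnonneg, fun r => (Finset.single_le_sum (fun i _ => hnonneg i) (Finset.mem_univ r)).trans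
    (le_sub_iff_add_le'.2 hsum)⟩

/-- Feasible steps with the largest sum cannot be increased. -/
theorem IsForest.dualProgress (hF : D.IsForest H 𝒩) (hN : IsNodeSet 𝒩) (hpm : D.NoPlusMinus 𝒩)
    (hmm : D.MinusMatched 𝒩) (hodd : ∀ S ∈ 𝒩, Odd S.card) {G : SimpleGraph V} {w : Sym2 V → ℝ}
    {y : Finset V → ℝ} {K : ℝ}
    (hK : ∀ y, DualFeasible G w y → ∑ S : Finset V with Odd S.card, y S ≤ K)
    {δ₀ : Finset V → ℝ} (h₀ : D.IsFeasibleStep G w 𝒩 y δ₀) (hpos : ∃ r, 0 < δ₀ r) :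
    D.DualProgress G w 𝒩 y := by
  obtain ⟨δ, hδ, hmax⟩ := (hF.isCompact_isFeasibleStep hN hpm hmm hodd y hK).exists_isMaxOn
    ⟨δ₀, h₀⟩ (f := fun δ : Finset V → ℝ => ∑ r, δ r) (by fun_prop)
  refine ⟨hpm, δ, hδ, ?_, fun δ' hδ' hle => ?_⟩
  · obtain ⟨r, hr⟩ := hpos
    have hnonneg := ((hF.isFeasibleStep_iff hN hpm).1 h₀).1
    have hsum : 0 < ∑ r, δ r :=
      (Finset.sum_pos' (fun r _ => hnonneg r) ⟨r, Finset.mem_univ r, hr⟩).trans_le (hmax h₀)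
    by_contra! hneg
    exact hsum.not_ge (Finset.sum_nonpos fun r _ => hneg r)
  · have heq := (Finset.sum_eq_sum_iff_of_le fun r _ => hle r).1
      (le_antisymm (Finset.sum_le_sum fun r _ => hle r) (hmax hδ'))
    exact funext fun r => (heq r (Finset.mem_univ r)).symm

end Progress

end AltData

/-! ### No perfect matching in a stuck state -/

open Filter Topology

theorem eventually_nonneg_add_mul {c d : ℝ} (hc : 0 ≤ c) (hd : c = 0 → 0 ≤ d) :
    ∀ᶠ ε in 𝓝[>] (0 : ℝ), 0 ≤ c + d * ε := by
  rcases hc.eq_or_lt with h0 | h0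
  · filter_upwards [self_mem_nhdsWithin] with ε hε
    rw [← h0, zero_add]
    exact mul_nonneg (hd h0.symm) (le_of_lt hε)
  · have htendsto : Tendsto (fun ε : ℝ => c + d * ε) (𝓝[>] 0) (𝓝 (c + d * 0)) :=
      ((by fun_prop : Continuous fun ε : ℝ => c + d * ε).tendsto 0).mono_left nhdsWithin_le_nhds
    filter_upwards [htendsto.eventually (lt_mem_nhds (by simpa using h0))] with ε hε
    exact hε.le

theorem slack_add_mul {V : Type*} [Fintype V] [DecidableEq V] (w : Sym2 V → ℝ)
    (y σ : Finset V → ℝ) (ε : ℝ) {a b : V} (hab : a ≠ b) :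
    slack w (fun S => y S + σ S * ε) a b = slack w y a b +
      (-∑ S : Finset V with Odd S.card ∧ (a ∈ S ∧ b ∉ S ∨ b ∈ S ∧ a ∉ S), σ S) * ε := by
  rw [slack_eq_sum _ _ hab, slack_eq_sum _ _ hab, Finset.sum_add_distrib, ← Finset.sum_mul]
  ring

theorem AltData.Joined.symm {V : Type*} {H : SimpleGraph V} {u v : Finset V} :
    Joined H u v → Joined H v u :=
  fun ⟨a, ha, b, hb, hab⟩ => ⟨b, hb, a, ha, hab.symm⟩

theorem AltData.sign_nonpos {V : Type*} {D : AltData V} {𝒩 : Finset (Finset V)} {S : Finset V}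
    (hS : S ∉ D.plus) : D.sign 𝒩 S ≤ 0 := by
  rw [sign, if_neg fun h => hS h.2]
  split_ifs <;> norm_num

namespace CherryState

open AltData

variable {V : Type*} [Fintype V] [DecidableEq V] {s : CherryState V} {G : SimpleGraph V}
  {w : Sym2 V → ℝ}

theorem IsValid.odd_card (hs : s.IsValid G w) {S : Finset V} (hS : S ∈ nodes s.blossoms) :
    Odd S.card := by
  induction hn : S.card using Nat.strong_induction_on generalizing S with
  | _ n ih =>
    subst hn
    rcases mem_nodes.1 hS with ⟨v, rfl⟩ | hB
    · simp
    · have hN := hs.laminar.isNodeSet_children S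
      have hcard : S.card = ∑ u ∈ children s.blossoms S, u.card := by
        conv_lhs => rw [← merge_children (𝓑 := s.blossoms) (hs.laminar.1 S hB)]
        exact Finset.card_biUnion fun u hu v hv huv => hN.2 u hu v hv huv
      have hodd : ∀ u ∈ children s.blossoms S, Odd u.card := by
        intro u hu
        rw [children_eq_maxNodes, mem_maxNodes] at hu
        exact ih _ (Finset.card_lt_card hu.2.1) hu.1 rfl
      rw [hcard, Finset.odd_sum_iff_odd_card_odd, Finset.filter_true_of_mem hodd]
      exact (hs.supernode S hB).1

theorem IsValid.odd_card_top (hs : s.IsValid G w) {S : Finset V} (hS : S ∈ s.top) :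
    Odd S.card :=
  hs.odd_card (Finset.mem_filter.1 hS).1

theorem IsValid.exists_free_mate (hs : s.IsValid G w) {x : Finset V} (hx : x ∈ s.top)
    (hf : s.IsFree x) : ∃ z ∈ s.top, s.Mates x z ∧ s.IsFree z := by
  have hN : IsNodeSet s.top := hs.laminar.isNodeSet_topNodes
  have hF := hs.forest
  have hr : ¬ s.IsRoot s.top x := fun h => hf.1 (hF.root x h).1
  obtain ⟨z, hz, hM⟩ : ∃ z ∈ s.top, s.Mates x z := by
    by_contra! h
    exact hr ⟨hx, h⟩
  refine ⟨z, hz, hM, fun hp => ?_, fun hm => ?_⟩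
  · obtain ⟨l, -, hl⟩ := hF.exists_altPath_cons_of_mates hN hz hp hx hM.symm
    exact hf.2 hl.mem_minus
  · obtain ⟨v, hv, hvp, hM'⟩ := hs.minusMatched z hz hm
    exact hf.1 (hF.matching.mates_unique hN hz hv hx hM' hM.symm ▸ hvp)

/-- Otherwise the joining edge would allow a grow-out, grow-in or augment operation. -/
theorem IsStuck.mem_minus_of_joined (hs : s.IsValid G w) (h : s.IsStuck G w) {A B : Finset V}
    (hA : A ∈ s.top) (hB : B ∈ s.top) (hAB : A ≠ B) (hJ : Joined (tightGraph G w s.y) A B)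
    (hAp : A ∈ s.plus) : B ∈ s.minus := by
  have hpm := h.noPlusMinus hs
  by_contra hBm
  by_cases hBp : B ∈ s.plus
  · obtain ⟨r, hr⟩ := hs.forest.exists_inTree hA (Or.inl hAp)
    obtain ⟨r', hr'⟩ := hs.forest.exists_inTree hB (Or.inl hBp)
    by_cases hrr : r = r'
    · subst hrr
      refine h.2.1 (Or.inr (Or.inl ⟨A, hA, B, hB, hAp, hBp, ?_, hJ, r, hr, hr'⟩))
      rwa [base_eq_self (mem_pureTop.2 ⟨hA, hpm A hA⟩), base_eq_self (mem_pureTop.2 ⟨hB, hpm B hB⟩)]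
    · exact h.2.1 (Or.inr (Or.inr (Or.inl
        ⟨A, hA, B, hB, hAp, hBp, hJ, r, r', hr, hr', hrr⟩)))
  · obtain ⟨z, hz, hM, hzf⟩ := hs.exists_free_mate hB ⟨hBp, hBm⟩
    exact h.2.1 (Or.inl ⟨A, hA, B, hB, z, hz, hAp, hJ, hM, ⟨hBp, hBm⟩, hzf⟩)

theorem IsStuck.sign_add_sign_nonpos (hs : s.IsValid G w) (h : s.IsStuck G w) {A B : Finset V}
    (hA : A ∈ s.top) (hB : B ∈ s.top) (hAB : A ≠ B) (hJ : Joined (tightGraph G w s.y) A B) :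
    s.sign s.top A + s.sign s.top B ≤ 0 := by
  have hpm := h.noPlusMinus hs
  by_cases hAp : A ∈ s.plus
  · rw [sign_plus hA hAp, sign_minus hB hpm (h.mem_minus_of_joined hs hA hB hAB hJ hAp),
      add_neg_cancel]
  · by_cases hBp : B ∈ s.plus
    · rw [sign_plus hB hBp, sign_minus hA hpm (h.mem_minus_of_joined hs hB hA hAB.symm hJ.symm hBp),
        neg_add_cancel]
    · exact add_nonpos (sign_nonpos hAp) (sign_nonpos hBp)

theorem IsStuck.sum_sign_nonpos (hs : s.IsValid G w) (h : s.IsStuck G w) {a b : V}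
    (hadj : (tightGraph G w s.y).Adj a b) :
    ∑ S : Finset V with Odd S.card ∧ (a ∈ S ∧ b ∉ S ∨ b ∈ S ∧ a ∉ S), s.sign s.top S ≤ 0 := by
  have hN : IsNodeSet s.top := hs.laminar.isNodeSet_topNodes
  obtain ⟨A, hA, ha⟩ : ∃ A ∈ s.top, a ∈ A := exists_mem_topNodes a
  obtain ⟨B, hB, hb⟩ : ∃ B ∈ s.top, b ∈ B := exists_mem_topNodes b
  by_cases hAB : A = B
  · subst hAB
    refine (Finset.sum_eq_zero fun S hS => sign_eq_zero fun hS' => ?_).le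
    rcases (Finset.mem_filter.1 hS).2.2 with ⟨h1, h2⟩ | ⟨h1, h2⟩
    · exact h2 (hN.eq_of_mem hA hS'.1 ha h1 ▸ hb)
    · exact h2 (hN.eq_of_mem hA hS'.1 hb h1 ▸ ha)
  · rw [← Finset.sum_subset (s₁ := {A, B}), Finset.sum_pair hAB]
    · exact h.sign_add_sign_nonpos hs hA hB hAB ⟨a, ha, b, hb, hadj⟩
    · intro S hS
      rw [Finset.mem_insert, Finset.mem_singleton] at hS
      simp only [Finset.mem_filter, Finset.mem_univ, true_and]
      rcases hS with rfl | rfl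
      · exact ⟨hs.odd_card_top hA, Or.inl ⟨ha, fun hb' => hAB (hN.eq_of_mem hA hB hb' hb)⟩⟩
      · exact ⟨hs.odd_card_top hB, Or.inr ⟨hb, fun ha' => hAB (hN.eq_of_mem hA hB ha ha')⟩⟩
    · intro S hS hS'
      refine sign_eq_zero fun hSt => hS' ?_
      rw [Finset.mem_insert, Finset.mem_singleton]
      rcases (Finset.mem_filter.1 hS).2.2 with ⟨h1, -⟩ | ⟨h1, -⟩
      · exact Or.inl (hN.eq_of_mem hSt.1 hA h1 ha)
      · exact Or.inr (hN.eq_of_mem hSt.1 hB h1 hb)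

/-- A minus-supernode with zero dual variable could be expanded. -/
theorem IsStuck.sign_nonneg_of_eq_zero (h : s.IsStuck G w) {S : Finset V} (hS : 1 < S.card)
    (hy : s.y S = 0) : 0 ≤ s.sign s.top S := by
  rw [sign]
  split_ifs with hplus hminus
  · exact zero_le_one
  · exact (h.2.1 (Or.inr (Or.inr (Or.inr (Or.inr ⟨S, hminus.1, hminus.2,
      fun hp => hplus ⟨hminus.1, hp⟩, mem_blossoms_of_mem_top hminus.1 hS, hy⟩))))).elim
  · exact le_rfl

theorem IsStuck.eventually_dualFeasible (hs : s.IsValid G w) (h : s.IsStuck G w) :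
    ∀ᶠ ε in 𝓝[>] (0 : ℝ), DualFeasible G w fun S => s.y S + s.sign s.top S * ε := by
  simp only [DualFeasible, eventually_and, eventually_all]
  refine ⟨fun a b hab => ?_, fun S hodd hcard => ?_⟩
  · simp only [slack_add_mul _ _ _ _ hab.ne]
    exact eventually_nonneg_add_mul (hs.feasible.1 a b hab) fun h0 =>
      neg_nonneg.2 (h.sum_sign_nonpos hs ⟨hab, h0⟩)
  · exact eventually_nonneg_add_mul (hs.feasible.2 S hodd hcard) (h.sign_nonneg_of_eq_zero hcard)

open Classical in
theorem IsStuck.exists_feasibleStep (hs : s.IsValid G w) (h : s.IsStuck G w) :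
    ∃ δ, s.IsFeasibleStep G w s.top s.y δ ∧ ∃ r, 0 < δ r := by
  obtain ⟨ε, hfeasible, hε : 0 < ε⟩ :=
    ((h.eventually_dualFeasible hs).and self_mem_nhdsWithin).exists
  obtain ⟨r, hr⟩ := h.1
  refine ⟨fun r => if s.IsRoot s.top r then ε else 0, ?_, r, by simpa [hr] using hε⟩
  refine (hs.forest.isFeasibleStep_iff hs.laminar.isNodeSet_topNodes (h.noPlusMinus hs)).2
    ⟨fun r => ?_, fun r hr => if_neg hr, ?_⟩
  · split_ifs
    exacts [hε.le, le_rfl]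
  convert hfeasible using 2 with S
  rw [dualStep]
  by_cases hS : S ∈ s.top ∧ (S ∈ s.plus ∨ S ∈ s.minus)
  · rw [if_pos (inTree_treeRoot (hs.forest.exists_inTree hS.1 hS.2)).isRoot]
  · rw [sign_eq_zero hS, zero_mul, zero_mul]

theorem IsStuck.not_exists_isPerfectMatching (hs : s.IsValid G w) (h : s.IsStuck G w) :
    ¬ ∃ N : G.Subgraph, N.IsPerfectMatching := by
  rintro ⟨N, hN⟩
  obtain ⟨K, hK⟩ := exists_dual_bound (w := w) hN
  obtain ⟨δ, hδ, hpos⟩ := h.exists_feasibleStep hs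
  exact h.2.2 (hs.forest.dualProgress hs.laminar.isNodeSet_topNodes (h.noPlusMinus hs)
    hs.minusMatched (fun S hS => hs.odd_card_top hS) hK hδ hpos)

end CherryState

end Blossom

/-- (1) Every cherry blossom is contracted by a sequence of shrinks of odd alternating cycles.
(2) Every state of Blossom VI is realized by a state of the traditional algorithm, which is stuck if
Blossom VI is stuck. (3) If Blossom VI is stuck, there is no perfect matching. -/
theorem mainTheorem2 {V : Type*} [Fintype V] [DecidableEq V] :
    (∀ (H : SimpleGraph V) (𝒩 : Finset (Finset V)) (D : Blossom.CherryData V),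
      Blossom.IsNodeSet 𝒩 → D.IsCherryForest H 𝒩 →
        ∀ x ∈ 𝒩, x ∈ D.plus → x ∉ D.minus →
          Relation.ReflTransGen (Blossom.OddCycleShrink H D.M x) 𝒩
            (Blossom.contract 𝒩 (D.cherryBlossom 𝒩 x))) ∧
    ∀ (G : SimpleGraph V) (w : Sym2 V → ℝ) (s : Blossom.CherryState V), s.IsValid G w →
      (∃ t : Blossom.TradState V, t.IsValid G w ∧ s.RealizedBy t ∧
        (s.IsStuck G w → t.IsStuck G w)) ∧
      (s.IsStuck G w → ¬ ∃ N : G.Subgraph, N.IsPerfectMatching) := by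
  refine ⟨fun H 𝒩 D hN hF x hx _ hm => hF.shrink_to_contract hN hx hm, fun G w s hs => ⟨?_, ?_⟩⟩
  · obtain ⟨t, ht, hst⟩ := Blossom.CherryState.exists_realizedBy hs
    exact ⟨t, ht, hst, fun h => hst.isStuck hs ht h⟩
  · exact fun h => h.not_exists_isPerfectMatching hs
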